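/- Let $\mathcal H\neq\{0\}$ be a (real or complex, possibly finite-dimensional, not necessarily separable) Hilbert space, and let $\mathfrak M(\mathcal H)$ be the set of complex Borel measures $\mu$ on $\mathcal H$ (of bounded variation) whose variation $|\mu|$ is a Radon measure, i.e. finite on compact sets, inner regular with respect to compact sets and outer regular with respect to open sets on all Borel sets. For an integer $k\ge 0$ let $CM_k$ be the set of continuous functions $\psi:[0,\infty)\to\mathbb R$ that are $C^\infty$ on $(0,\infty)$ and for which $(-1)^k\psi^{(k)}$ is completely monotone on $(0,\infty)$, i.e. $(-1)^{n+k}\psi^{(n+k)}(t)\ge 0$ for all $t>0$ and $n\ge 0$. Let $\ell\ge 1$ be an integer and let $\psi:[0,\infty)\to\mathbb R$ and $\mu\in\mathfrak M(\mathcal H)$ be such that $\|x\|^{2(\ell-1)}\in L^1(|\mu|)$ and $\psi(\|x-y\|^2)\in L^1(|\mu|\times|\mu|)$. Suppose that one of the following holds: (i) $\psi(t)=t^{a/2}$ for some real $a$ with $2(\ell-1)<a<2\ell$; (ii) $\ell>1$ and $\psi(t)=t^{\ell-1}\log t$ (with $\psi(0)=0$); (iii) $\ell=1$, $\psi\in CM_1$,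 $\psi$ is not a polynomial, and $\psi(0)\le 0$; (iv) $\ell=2$, $\psi\in CM_2$, $\psi$ is not a polynomial, $\psi(0)\le 0$, and moreover $\|x\|^{4}\in L^1(|\mu|)$. Then $x\mapsto\psi(\|x-y\|^2)$ is $|\mu|$-integrable for every $y\in\mathcal H$, and $$\int_{\mathcal H}\psi(\|x-y\|^2)\,d\mu(x)=0\quad\text{for every } y\in\mathcal H$$ if and only if $\mu=0$. -/

import Mathlib

open MeasureTheory Set
open scoped ContDiff

/-- `f` is completely monotone on `(0, ∞)`: it is smooth there and `(-1)^n f^(n) ≥ 0` for all `n`.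
Only the values of `f` on `(0, ∞)` matter. -/
structure IsCompletelyMonotone (f : ℝ → ℝ) : Prop where
  contDiffOn : ContDiffOn ℝ ∞ f (Ioi 0)
  nonneg : ∀ (n : ℕ) (t : ℝ), 0 < t → 0 ≤ (-1 : ℝ) ^ n * iteratedDeriv n f t

/-- The class `CM_ℓ` of continuous functions `ψ : [0, ∞) → ℝ` that are smooth on `(0, ∞)` and for
which `(-1)^ℓ ψ^(ℓ)` is completely monotone on `(0, ∞)`. A function on `[0, ∞)` is represented by
a function on `ℝ`, whose values on `(-∞, 0)` play no role. -/
structure IsCM (ℓ : ℕ) (ψ : ℝ → ℝ) : Prop where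
  continuousOn : ContinuousOn ψ (Ici 0)
  contDiffOn : ContDiffOn ℝ ∞ ψ (Ioi 0)
  completelyMonotone : IsCompletelyMonotone fun t => (-1 : ℝ) ^ ℓ * iteratedDeriv ℓ ψ t

/-- `ψ` coincides on `[0, ∞)` with a polynomial. -/
def IsPolynomialOnIci (ψ : ℝ → ℝ) : Prop :=
  ∃ p : Polynomial ℝ, ∀ t : ℝ, 0 ≤ t → ψ t = p.eval t

/-- A complex measure belongs to `𝔐(X)` if its variation is a Radon measure: finite on compact
sets, and both inner regular with respect to compact sets and outer regular with respect to open
sets on all Borel sets. (The variation of a complex measure is always finite.) -/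
structure IsRadonComplexMeasure {X : Type*} [TopologicalSpace X] [MeasurableSpace X]
    (μ : ComplexMeasure X) : Prop where
  finiteOnCompacts : IsFiniteMeasureOnCompacts μ.variation
  innerRegular : μ.variation.InnerRegular
  outerRegular : μ.variation.OuterRegular

/-! Put n = ℓ - 1. In each case ψ or -ψ lies in CM_(n+1) and ψ is not a polynomial. By Bernstein's
theorem (`IsCompletelyMonotone.exists_laplace`), (-1)^(n+1) ψ^(n+1) is the Laplace transform of a
measure ν on [0, ∞). Taylor's formula at 1 then writes ψ as a polynomial plus, up to sign, a
ν-mixture of the Taylor remainders of e^(-st) (`IsCM.exists_hasLaplaceTaylor`). Modulo polynomials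
of degree at most n + 1, the remainder for s > 0 is (-s)^(-(n+1)) e^(-st).

If all potentials vanish, so do all translated double energies of a real density g of μ with respect
to ρ = |μ|. Taking m-th differences along a vector e in both variables, with m = 2n + 3, kills every
polynomial part, so no moments of g have to vanish. What remains is that s^(-(n+1)) G(s) has
ν-integral zero over s > 0, where G(s), the `gaussianForm`, is a squared norm in the reproducing
kernel space of the Gaussian. Since ψ is not a polynomial, ν charges (0, ∞), so G(s) = 0 for some s
> 0. The Gaussian potential of gρ then has zero m-th difference in direction e and decays in that
direction, hence is zero. Completing the square turns this into a vanishing moment generating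
function, which forces g = 0 (`ae_eq_zero_of_integral_gaussian_mul`).

Two reductions lead there: inner regularity puts |μ| on a separable closed subspace, and the real
and imaginary parts of μ have densities bounded by one. The integrability of all translates comes
from a doubling estimate for ψ minus its Taylor polynomial (`HasLaplaceTaylor.exists_growth_bound`).
-/

/-! ### Taylor expansion of completely monotone functions -/

theorem iteratedDerivWithin_uIcc_eq {φ : ℝ → ℝ} {U : Set ℝ} (hU : IsOpen U)
    (hφ : ContDiffOn ℝ ∞ φ U) {a t u : ℝ} (hsub : uIcc a t ⊆ U) (hat : a ≠ t)
    (hu : u ∈ uIcc a t) (n : ℕ) :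
    iteratedDerivWithin n φ (uIcc a t) u = iteratedDeriv n φ u :=
  iteratedDerivWithin_eq_iteratedDeriv (uniqueDiffOn_uIcc hat)
    ((hφ.contDiffAt (hU.mem_nhds (hsub hu))).of_le (by exact_mod_cast le_top)) hu

/-- Taylor's formula with integral remainder for smooth functions on an open set. -/
theorem taylor_formula {φ : ℝ → ℝ} {U : Set ℝ} (hU : IsOpen U) (hφ : ContDiffOn ℝ ∞ φ U)
    {a t : ℝ} (hsub : uIcc a t ⊆ U) (n : ℕ) :
    φ t = ∑ k ∈ Finset.range (n + 1), iteratedDeriv k φ a / (k.factorial : ℝ) * (t - a) ^ k +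
      ∫ u in a..t, (t - u) ^ n / (n.factorial : ℝ) * iteratedDeriv (n + 1) φ u := by
  rcases eq_or_ne a t with rfl | hat
  · rw [intervalIntegral.integral_same, Finset.sum_range_succ']
    simp
  have h := taylor_integral_remainder (f := φ) (x := t) (x₀ := a) (n := n)
    ((hφ.mono hsub).of_le (by exact_mod_cast le_top))
  rw [sub_eq_iff_eq_add'] at h
  rw [h, taylor_within_apply]
  congr 1
  · refine Finset.sum_congr rfl fun k _ => ?_
    rw [iteratedDerivWithin_uIcc_eq hU hφ hsub hat left_mem_uIcc, smul_eq_mul]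
    ring
  · refine intervalIntegral.integral_congr fun u hu => ?_
    simp only [smul_eq_mul]
    rw [iteratedDerivWithin_uIcc_eq hU hφ hsub hat hu]

theorem uIcc_subset_Ioi {a t : ℝ} (ha : 0 < a) (ht : 0 < t) : uIcc a t ⊆ Ioi 0 :=
  fun _ hu => lt_of_lt_of_le (lt_min ha ht) hu.1

theorem continuousOn_iteratedDeriv_Ioi {φ : ℝ → ℝ} (hφ : ContDiffOn ℝ ∞ φ (Ioi 0)) (n : ℕ) :
    ContinuousOn (iteratedDeriv n φ) (Ioi 0) := by
  have h := hφ.continuousOn_iteratedDerivWithin (m := n) (by exact_mod_cast le_top)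
    (uniqueDiffOn_Ioi 0)
  refine h.congr fun u hu => ?_
  exact (iteratedDerivWithin_eq_iteratedDeriv (uniqueDiffOn_Ioi 0)
    ((hφ.contDiffAt (Ioi_mem_nhds hu)).of_le (by exact_mod_cast le_top)) hu).symm

namespace IsCompletelyMonotone

variable {f : ℝ → ℝ}

/-- The remainder of the `n`-th Taylor polynomial at `T`, evaluated at `t`. -/
theorem sum_add_remainder (hf : IsCompletelyMonotone f) {t T : ℝ} (ht : 0 < t) (hT : 0 < T)
    (n : ℕ) :
    f t = ∑ k ∈ Finset.range (n + 1),
        (-1) ^ k * iteratedDeriv k f T / (k.factorial : ℝ) * (T - t) ^ k +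
      ∫ u in t..T, (u - t) ^ n / (n.factorial : ℝ) * ((-1) ^ (n + 1) * iteratedDeriv (n + 1) f u) := by
  conv_lhs => rw [taylor_formula isOpen_Ioi hf.contDiffOn (uIcc_subset_Ioi hT ht) n]
  congr 1
  · refine Finset.sum_congr rfl fun k _ => ?_
    rw [← neg_sub T t, neg_pow]
    ring
  · rw [intervalIntegral.integral_symm, ← intervalIntegral.integral_neg]
    refine intervalIntegral.integral_congr fun u _ => ?_
    rw [← neg_sub u t, neg_pow]
    ring

theorem intervalIntegrable_remainder (hf : IsCompletelyMonotone f) {t T : ℝ} (a : ℝ) (ht : 0 < t)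
    (hT : 0 < T) (n : ℕ) :
    IntervalIntegrable (fun u => (u - a) ^ n / (n.factorial : ℝ) *
      ((-1) ^ (n + 1) * iteratedDeriv (n + 1) f u)) volume t T := by
  apply ContinuousOn.intervalIntegrable
  have h := (continuousOn_iteratedDeriv_Ioi hf.contDiffOn (n + 1)).mono (uIcc_subset_Ioi ht hT)
  fun_prop

theorem remainder_le (hf : IsCompletelyMonotone f) {t T : ℝ} (ht : 0 < t) (hT : t ≤ T) (n : ℕ) :
    ∫ u in t..T, (u - t) ^ n / (n.factorial : ℝ) * ((-1) ^ (n + 1) * iteratedDeriv (n + 1) f u) ≤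
      f t := by
  have hT0 := ht.trans_le hT
  rw [hf.sum_add_remainder ht hT0 n]
  refine le_add_of_nonneg_left (Finset.sum_nonneg fun k _ => ?_)
  have := hf.nonneg k T hT0
  have : 0 ≤ T - t := sub_nonneg.2 hT
  positivity

/-- A completely monotone function is the sum of its Taylor series at `T` on `(0, T]`. -/
theorem hasSum_taylor (hf : IsCompletelyMonotone f) {t T : ℝ} (ht : 0 < t) (hT : t ≤ T) :
    HasSum (fun k : ℕ => (-1) ^ k * iteratedDeriv k f T / (k.factorial : ℝ) * (T - t) ^ k)
      (f t) := by
  have hT0 := ht.trans_le hT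
  have hTt : 0 ≤ T - t := sub_nonneg.2 hT
  rw [hasSum_iff_tendsto_nat_of_nonneg]
  swap
  · intro k
    have := hf.nonneg k T hT0
    positivity
  rw [← Filter.tendsto_add_atTop_iff_nat 1]
  set r : ℕ → ℝ := fun n => ∫ u in t..T,
    (u - t) ^ n / (n.factorial : ℝ) * ((-1) ^ (n + 1) * iteratedDeriv (n + 1) f u) with hr
  have hsum : ∀ n, ∑ k ∈ Finset.range (n + 1),
      (-1) ^ k * iteratedDeriv k f T / (k.factorial : ℝ) * (T - t) ^ k = f t - r n := fun n => by
    rw [hf.sum_add_remainder ht hT0 n]; ring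
  simp_rw [hsum]
  suffices h : Filter.Tendsto r Filter.atTop (nhds 0) by
    simpa using (tendsto_const_nhds (x := f t)).sub h
  -- On [t, T] the ratio (u - t) / (u - t/2) is at most q < 1, its value at u = T. Hence the
  -- remainder at t is at most q ^ n times one based at t / 2, and the latter is bounded by f (t /
  -- 2) because all Taylor terms are nonnegative.
  set q : ℝ := (T - t) / (T - t / 2) with hq
  have hd : 0 < T - t / 2 := by linarith
  have hq0 : 0 ≤ q := by positivity
  have hq1 : q < 1 := by rw [hq, div_lt_one hd]; linarith
  have hnn : ∀ u ∈ Icc t T, ∀ n, 0 ≤ (-1) ^ n * iteratedDeriv n f u := fun u hu n =>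
    hf.nonneg n u (ht.trans_le hu.1)
  refine squeeze_zero (g := fun n => q ^ n * f (t / 2)) (fun n => ?_) (fun n => ?_) ?_
  · refine intervalIntegral.integral_nonneg hT fun u hu => ?_
    have := hnn u hu (n + 1)
    have : 0 ≤ u - t := sub_nonneg.2 hu.1
    positivity
  · have h2 : ∫ u in t..T, (u - t / 2) ^ n / (n.factorial : ℝ) *
        ((-1) ^ (n + 1) * iteratedDeriv (n + 1) f u) ≤ f (t / 2) := by
      refine le_trans ?_ (hf.remainder_le (T := T) (half_pos ht) (by linarith) n)
      have hi := hf.intervalIntegrable_remainder (T := t) (t / 2) (half_pos ht) ht n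
      have hi' := hf.intervalIntegrable_remainder (T := T) (t / 2) ht hT0 n
      rw [← intervalIntegral.integral_add_adjacent_intervals hi hi']
      refine le_add_of_nonneg_left (intervalIntegral.integral_nonneg (by linarith) fun u hu => ?_)
      have := hf.nonneg (n + 1) u ((half_pos ht).trans_le hu.1)
      have : 0 ≤ u - t / 2 := sub_nonneg.2 hu.1
      positivity
    refine le_trans ?_ (mul_le_mul_of_nonneg_left h2 (pow_nonneg hq0 n))
    rw [← intervalIntegral.integral_const_mul]
    refine intervalIntegral.integral_mono_on hT (hf.intervalIntegrable_remainder t ht hT0 n)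
      ((hf.intervalIntegrable_remainder (t / 2) ht hT0 n).const_mul _) fun u hu => ?_
    have h3 := hnn u hu (n + 1)
    have h4 : u - t ≤ q * (u - t / 2) := by
      rw [hq, div_mul_eq_mul_div, le_div_iff₀ hd]
      nlinarith [hu.1, hu.2]
    have h5 : (u - t) ^ n ≤ q ^ n * (u - t / 2) ^ n := by
      rw [← mul_pow]
      exact pow_le_pow_left₀ (sub_nonneg.2 hu.1) h4 n
    calc _ ≤ (q ^ n * (u - t / 2) ^ n) / (n.factorial : ℝ) *
          ((-1) ^ (n + 1) * iteratedDeriv (n + 1) f u) := by gcongr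
      _ = _ := by ring
  · simpa using (tendsto_pow_atTop_nhds_zero_of_lt_one hq0 hq1).mul_const (f (t / 2))

end IsCompletelyMonotone

/-! ### Bernstein's theorem through the Hausdorff moment problem -/

section Bernstein

open Filter Topology unitInterval

/-- Finite measures on the unit interval are determined by their moments. -/
theorem measure_unitInterval_ext {M N : Measure I} [IsFiniteMeasure M] [IsFiniteMeasure N]
    (h : ∀ n : ℕ, ∫ x, (x : ℝ) ^ n ∂M = ∫ x, (x : ℝ) ^ n ∂N) : M = N := by
  -- Polynomial functions form a point-separating subalgebra, so it is enough to compare their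
  -- integrals.
  let A : StarSubalgebra ℝ (BoundedContinuousFunction I ℝ) :=
    { carrier := {g | ∃ p : Polynomial ℝ, ∀ x : I, g x = p.eval (x : ℝ)}
      mul_mem' := by
        rintro a b ⟨p, hp⟩ ⟨q, hq⟩
        exact ⟨p * q, fun x => by simp [hp, hq]⟩
      add_mem' := by
        rintro a b ⟨p, hp⟩ ⟨q, hq⟩
        exact ⟨p + q, fun x => by simp [hp, hq]⟩
      algebraMap_mem' := fun r => ⟨Polynomial.C r, fun x => by simp⟩
      star_mem' := by
        rintro a ⟨p, hp⟩
        exact ⟨p, fun x => by simp [hp]⟩ }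
  refine ext_of_forall_mem_subalgebra_integral_eq_of_polish (𝕜 := ℝ) (A := A) ?_ ?_
  · intro x y hxy
    let g : BoundedContinuousFunction I ℝ :=
      BoundedContinuousFunction.mkOfCompact ⟨fun x : I => (x : ℝ), continuous_subtype_val⟩
    refine ⟨fun x : I => (x : ℝ), ⟨⟨_, continuous_subtype_val⟩, ?_, rfl⟩,
      fun h => hxy (Subtype.ext h)⟩
    exact ⟨g, ⟨Polynomial.X, fun x => by simp [g]⟩, rfl⟩
  · rintro g ⟨p, hp⟩
    have hint : ∀ (P : Measure I) [IsFiniteMeasure P] (n : ℕ),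
        Integrable (fun x : I => p.coeff n * (x : ℝ) ^ n) P := fun P _ n =>
      (Continuous.integrable_of_hasCompactSupport (by fun_prop)
        (HasCompactSupport.of_compactSpace _))
    simp_rw [hp, Polynomial.eval_eq_sum_range]
    rw [integral_finsetSum _ fun n _ => hint M n, integral_finsetSum _ fun n _ => hint N n]
    simp_rw [integral_const_mul, h]

namespace IsCompletelyMonotone

variable {f : ℝ → ℝ}

theorem tendsto_mul_one_sub_exp (r : ℝ) :
    Tendsto (fun n : ℕ => (n : ℝ) * (1 - Real.exp (-r / n))) atTop (𝓝 r) := by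
  have h : HasDerivAt (fun u : ℝ => 1 - Real.exp (-r * u)) r 0 := by
    have h1 : HasDerivAt (fun u : ℝ => -r * u) (-r) 0 := by
      simpa using (hasDerivAt_id (0 : ℝ)).const_mul (-r)
    simpa using (h1.exp).const_sub 1
  have h2 := hasDerivAt_iff_tendsto_slope_zero.1 h
  have h3 : Tendsto (fun n : ℕ => ((n : ℝ))⁻¹) atTop (𝓝[≠] 0) := by
    refine tendsto_nhdsWithin_iff.2 ⟨tendsto_inv_atTop_nhds_zero_nat, ?_⟩
    filter_upwards [eventually_gt_atTop 0] with n hn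
    simp [hn.ne']
  refine (h2.comp h3).congr fun n => ?_
  simp [div_eq_mul_inv]

/-- A discrete measure whose moments are values of a completely monotone function. -/
theorem exists_discrete_measure (hf : IsCompletelyMonotone f) {T δ : ℝ} (hT : 0 < T)
    (hδ : 0 < δ) :
    ∃ M : Measure I, ∀ τ : ℝ, 0 ≤ τ → ∫⁻ x, ENNReal.ofReal ((x : ℝ) ^ τ) ∂M =
      ENNReal.ofReal (f (T * (1 - Real.exp (-(δ + τ) / T)))) := by
  -- The expansion at T reads f (T (1 - w)) = ∑ a k * w ^ k with a k ≥ 0. For w = exp (-(δ + τ) / T)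
  -- the k-th term is the mass a k * exp (-k δ / T) times the τ-th power of the node exp (-k / T).
  set a : ℕ → ℝ := fun k => (-1) ^ k * iteratedDeriv k f T / (k.factorial : ℝ) * T ^ k with ha
  have ha0 : ∀ k, 0 ≤ a k := fun k => by
    have := hf.nonneg k T hT
    positivity
  have hmem : ∀ k : ℕ, Real.exp (-k / T) ∈ I := fun k =>
    ⟨(Real.exp_pos _).le, Real.exp_le_one_iff.2 (by rw [neg_div, neg_nonpos]; positivity)⟩
  refine ⟨Measure.sum fun k : ℕ => ENNReal.ofReal (a k * Real.exp (-k * δ / T)) •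
    Measure.dirac ⟨Real.exp (-k / T), hmem k⟩, fun τ hτ => ?_⟩
  have hr : 0 < δ + τ := by positivity
  have he : Real.exp (-(δ + τ) / T) < 1 := by
    rw [Real.exp_lt_one_iff, neg_div, neg_lt_zero]
    positivity
  have hsum := hf.hasSum_taylor (t := T * (1 - Real.exp (-(δ + τ) / T))) (T := T)
    (mul_pos hT (by linarith)) (by nlinarith [Real.exp_pos (-(δ + τ) / T)])
  have hterm : ∀ k : ℕ, (-1) ^ k * iteratedDeriv k f T / (k.factorial : ℝ) *
      (T - T * (1 - Real.exp (-(δ + τ) / T))) ^ k =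
      a k * Real.exp (-k * δ / T) * Real.exp (-k / T) ^ τ := fun k => by
    rw [show T - T * (1 - Real.exp (-(δ + τ) / T)) = T * Real.exp (-(δ + τ) / T) by ring, mul_pow,
      ← Real.exp_nat_mul, ← Real.exp_mul, mul_assoc (a k), ← Real.exp_add, ha]
    rw [show (k : ℝ) * (-(δ + τ) / T) = -k * δ / T + -k / T * τ by field_simp; ring]
    ring
  simp_rw [hterm] at hsum
  rw [← hsum.tsum_eq, ENNReal.ofReal_tsum_of_nonneg _ hsum.summable, lintegral_sum_measure]
  · refine tsum_congr fun k => ?_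
    rw [lintegral_smul_measure, lintegral_dirac' _ (by fun_prop), smul_eq_mul,
      ← ENNReal.ofReal_mul (mul_nonneg (ha0 k) (Real.exp_pos _).le)]
  · intro k
    have := ha0 k
    positivity

theorem integrable_rpow (M : Measure I) [IsFiniteMeasure M] {τ : ℝ} (hτ : 0 ≤ τ) :
    Integrable (fun x : I => (x : ℝ) ^ τ) M :=
  Continuous.integrable_of_hasCompactSupport
    (continuous_subtype_val.rpow_const fun _ => Or.inr hτ) (HasCompactSupport.of_compactSpace _)

theorem continuousAt (hf : IsCompletelyMonotone f) {t : ℝ} (ht : 0 < t) : ContinuousAt f t :=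
  hf.contDiffOn.continuousOn.continuousAt (Ioi_mem_nhds ht)

/-- The Hausdorff moment form of Bernstein's theorem. -/
theorem exists_moment_measure (hf : IsCompletelyMonotone f) {δ : ℝ} (hδ : 0 < δ) :
    ∃ M : Measure I, IsFiniteMeasure M ∧
      ∀ τ : ℝ, 0 ≤ τ → ∫ x, (x : ℝ) ^ τ ∂M = f (δ + τ) := by
  -- Take T = n + 1 → ∞, where T (1 - exp (-r / T)) → r. The shift δ > 0 keeps the masses bounded,
  -- since f may blow up at 0.
  have hex : ∀ n : ℕ, ∃ M : Measure I, ∀ τ : ℝ, 0 ≤ τ → ∫⁻ x, ENNReal.ofReal ((x : ℝ) ^ τ) ∂M =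
      ENNReal.ofReal (f ((n + 1 : ℕ) * (1 - Real.exp (-(δ + τ) / (n + 1 : ℕ))))) := fun n =>
    hf.exists_discrete_measure (by positivity) hδ
  choose M hM using hex
  have hpos : ∀ (n : ℕ) (τ : ℝ), 0 ≤ τ →
      0 ≤ f ((n + 1 : ℕ) * (1 - Real.exp (-(δ + τ) / (n + 1 : ℕ)))) := fun n τ hτ => by
    have he : Real.exp (-(δ + τ) / (n + 1 : ℕ)) < 1 := by
      rw [Real.exp_lt_one_iff, neg_div, neg_lt_zero]
      positivity
    simpa using hf.nonneg 0 _ (mul_pos (by positivity : (0 : ℝ) < (n + 1 : ℕ)) (sub_pos.2 he))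
  have hmass : ∀ n, M n univ =
      ENNReal.ofReal (f ((n + 1 : ℕ) * (1 - Real.exp (-δ / (n + 1 : ℕ))))) := fun n => by
    have := hM n 0 le_rfl
    simpa using this
  have hfin : ∀ n, IsFiniteMeasure (M n) := fun n => ⟨by rw [hmass]; exact ENNReal.ofReal_lt_top⟩
  have hint : ∀ n (τ : ℝ), 0 ≤ τ → ∫ x, (x : ℝ) ^ τ ∂(M n) =
      f ((n + 1 : ℕ) * (1 - Real.exp (-(δ + τ) / (n + 1 : ℕ)))) := fun n τ hτ => by
    rw [integral_eq_lintegral_of_nonneg_ae (Eventually.of_forall fun x => Real.rpow_nonneg x.2.1 _)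
      (integrable_rpow (M n) hτ).aestronglyMeasurable, hM n τ hτ,
      ENNReal.toReal_ofReal (hpos n τ hτ)]
  have hlim : ∀ τ : ℝ, 0 ≤ τ → Tendsto
      (fun n : ℕ => f ((n + 1 : ℕ) * (1 - Real.exp (-(δ + τ) / (n + 1 : ℕ))))) atTop
      (𝓝 (f (δ + τ))) := fun τ hτ =>
    (hf.continuousAt (by positivity : 0 < δ + τ)).tendsto.comp
      ((tendsto_mul_one_sub_exp (δ + τ)).comp (tendsto_add_atTop_nat 1))
  let μs : ℕ → FiniteMeasure I := fun n => ⟨M n, hfin n⟩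
  have hbd : ∀ᶠ n in atTop, (μs n).mass ≤ Real.toNNReal (f δ + 1) := by
    have h0 := hlim 0 le_rfl
    rw [add_zero] at h0
    filter_upwards [h0.eventually (eventually_lt_nhds (lt_add_one (f δ)))] with n hn
    rw [← ENNReal.coe_le_coe, FiniteMeasure.ennreal_mass]
    change M n univ ≤ _
    rw [hmass]
    exact ENNReal.ofReal_le_ofReal hn.le
  -- Measures of bounded mass on a compact space are weakly compact; an ultrafilter limit avoids
  -- extracting a subsequence.
  let U : Ultrafilter ℕ := hyperfilter ℕ
  obtain ⟨N, -, hN⟩ := (isCompact_setOfPred_finiteMeasure_le_of_compactSpace I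
    (Real.toNNReal (f δ + 1))).ultrafilter_le_nhds' (U.map μs)
    (Nat.hyperfilter_le_atTop hbd)
  have hN' : Tendsto μs U (𝓝 N) := hN
  refine ⟨N, inferInstance, fun τ hτ => ?_⟩
  let g : BoundedContinuousFunction I ℝ := BoundedContinuousFunction.mkOfCompact
    ⟨fun x : I => (x : ℝ) ^ τ, continuous_subtype_val.rpow_const fun _ => Or.inr hτ⟩
  have h1 := FiniteMeasure.tendsto_iff_forall_integral_tendsto.1 hN' g
  have h2 : Tendsto _ (U : Filter ℕ) _ := (hlim τ hτ).mono_left Nat.hyperfilter_le_atTop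
  refine tendsto_nhds_unique h1 (h2.congr fun n => ?_)
  exact (hint n τ hτ).symm

/-- As τ decreases to 0, x ^ τ tends to the indicator of x ≠ 0, so by continuity of f at δ that set
has mass f δ. This is already the total mass, given by the moment τ = 0 with the convention 0 ^ 0 =
1. -/
theorem moment_measure_zero {δ : ℝ} (hf : IsCompletelyMonotone f) (hδ : 0 < δ) {M : Measure I}
    [IsFiniteMeasure M] (hM : ∀ τ : ℝ, 0 ≤ τ → ∫ x, (x : ℝ) ^ τ ∂M = f (δ + τ)) :
    ∀ᵐ x : I ∂M, (x : ℝ) ≠ 0 := by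
  have hlim : Tendsto (fun n : ℕ => ∫ x : I, (x : ℝ) ^ (1 / ((n : ℝ) + 1)) ∂M) atTop
      (𝓝 (∫ x : I, {x : I | (x : ℝ) ≠ 0}.indicator 1 x ∂M)) := by
    refine tendsto_integral_of_dominated_convergence (fun _ => 1)
      (fun n => (integrable_rpow M (by positivity)).aestronglyMeasurable) (integrable_const _)
      (fun n => Eventually.of_forall fun x => ?_) (Eventually.of_forall fun x => ?_)
    · rw [Real.norm_of_nonneg (Real.rpow_nonneg x.2.1 _)]
      exact Real.rpow_le_one x.2.1 x.2.2 (by positivity)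
    · rcases eq_or_ne (x : ℝ) 0 with h0 | h0
      · have : ∀ n : ℕ, (x : ℝ) ^ (1 / ((n : ℝ) + 1)) = 0 := fun n => by
          rw [h0, Real.zero_rpow (by positivity)]
        simp_rw [this]
        have h1 : x ∉ {x : I | (x : ℝ) ≠ 0} := fun h => h h0
        rw [indicator_of_notMem h1]
        exact tendsto_const_nhds
      · have h1 : x ∈ {x : I | (x : ℝ) ≠ 0} := h0
        rw [indicator_of_mem h1]
        have := (Real.continuousAt_const_rpow h0).tendsto.comp
          (tendsto_one_div_add_atTop_nhds_zero_nat (𝕜 := ℝ))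
        rw [Real.rpow_zero] at this
        exact this
  have hlim2 : Tendsto (fun n : ℕ => ∫ x : I, (x : ℝ) ^ (1 / ((n : ℝ) + 1)) ∂M) atTop
      (𝓝 (f δ)) := by
    have h := (hf.continuousAt hδ).tendsto
    have h2 : Tendsto (fun n : ℕ => δ + 1 / ((n : ℝ) + 1)) atTop (𝓝 δ) := by
      simpa using (tendsto_one_div_add_atTop_nhds_zero_nat (𝕜 := ℝ)).const_add δ
    exact (h.comp h2).congr fun n => (hM _ (by positivity)).symm
  have heq := tendsto_nhds_unique hlim hlim2
  have hms : MeasurableSet {x : I | (x : ℝ) ≠ 0} :=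
    (measurable_subtype_coe (measurableSet_singleton (0 : ℝ))).compl
  rw [integral_indicator_one hms] at heq
  have h0 := hM 0 le_rfl
  simp only [Real.rpow_zero, integral_const, smul_eq_mul, mul_one, add_zero] at h0
  have hc : M.real {x : I | (x : ℝ) ≠ 0}ᶜ = 0 := by
    rw [measureReal_compl hms, heq, h0, sub_self]
  rw [ae_iff]
  exact (measureReal_eq_zero_iff).1 hc

theorem lintegral_moment {δ : ℝ} {M : Measure I} [IsFiniteMeasure M]
    (hM : ∀ τ : ℝ, 0 ≤ τ → ∫ x, (x : ℝ) ^ τ ∂M = f (δ + τ)) {τ : ℝ} (hτ : 0 ≤ τ) :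
    ∫⁻ x, ENNReal.ofReal ((x : ℝ) ^ τ) ∂M = ENNReal.ofReal (f (δ + τ)) := by
  rw [← hM τ hτ, ofReal_integral_eq_lintegral_ofReal (integrable_rpow M hτ)
    (Eventually.of_forall fun x => Real.rpow_nonneg x.2.1 _)]

/-- **Bernstein's theorem**: a completely monotone function is the Laplace transform of a
measure on `[0, ∞)`. -/
theorem exists_laplace (hf : IsCompletelyMonotone f) :
    ∃ ν : Measure ℝ, SFinite ν ∧ (∀ᵐ s ∂ν, 0 ≤ s) ∧
      ∀ t : ℝ, 0 < t → Integrable (fun s => Real.exp (-s * t)) ν ∧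
        ∫ s, Real.exp (-s * t) ∂ν = f t := by
  obtain ⟨M, hMfin, hM⟩ := hf.exists_moment_measure one_pos
  have hM0 := hf.moment_measure_zero one_pos hM
  have key : ∀ t : ℝ, 0 < t →
      ∫⁻ x : I, ENNReal.ofReal ((x : ℝ) ^ (t - 1)) ∂M = ENNReal.ofReal (f t) := fun t ht => by
    rcases le_total 1 t with h1 | h1
    · rw [lintegral_moment hM (sub_nonneg.2 h1), add_sub_cancel]
    -- Here the exponent t - 1 is nonpositive. The measure N based at δ = t satisfies M = x ^ (1 -
    -- t) N by uniqueness of moments, and the total mass of N is f t.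
    · obtain ⟨N, hNfin, hN⟩ := hf.exists_moment_measure ht
      have hN0 := hf.moment_measure_zero ht hN
      have hmeas : Measurable fun x : I => ENNReal.ofReal ((x : ℝ) ^ (1 - t)) := by fun_prop
      have hfin : IsFiniteMeasure (N.withDensity fun x : I => ENNReal.ofReal ((x : ℝ) ^ (1 - t))) :=
        isFiniteMeasure_withDensity_ofReal (integrable_rpow N (sub_nonneg.2 h1)).2
      have hMN : M = N.withDensity fun x : I => ENNReal.ofReal ((x : ℝ) ^ (1 - t)) := by
        refine measure_unitInterval_ext fun n => ?_
        rw [integral_withDensity_eq_integral_toReal_smul hmeas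
          (Eventually.of_forall fun x => ENNReal.ofReal_lt_top)]
        have h2 : ∀ᵐ x : I ∂N, (ENNReal.ofReal ((x : ℝ) ^ (1 - t))).toReal • (x : ℝ) ^ n =
            (x : ℝ) ^ (1 - t + n) := by
          filter_upwards [hN0] with x hx
          have hx0 : 0 < (x : ℝ) := lt_of_le_of_ne x.2.1 hx.symm
          rw [ENNReal.toReal_ofReal (Real.rpow_nonneg x.2.1 _), smul_eq_mul, Real.rpow_add hx0,
            Real.rpow_natCast]
        rw [integral_congr_ae h2, hN _ (by have := sub_nonneg.2 h1; positivity)]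
        have := hM n (by positivity)
        simp only [Real.rpow_natCast] at this
        rw [this]
        congr 1
        ring
      rw [hMN, lintegral_withDensity_eq_lintegral_mul _ hmeas (by fun_prop)]
      have h2 : ∀ᵐ x : I ∂N, ((fun x : I => ENNReal.ofReal ((x : ℝ) ^ (1 - t))) *
          fun x : I => ENNReal.ofReal ((x : ℝ) ^ (t - 1))) x = ENNReal.ofReal ((x : ℝ) ^ (0 : ℝ)) := by
        filter_upwards [hN0] with x hx
        have hx0 : 0 < (x : ℝ) := lt_of_le_of_ne x.2.1 hx.symm
        rw [Pi.mul_apply, ← ENNReal.ofReal_mul (Real.rpow_nonneg x.2.1 _), ← Real.rpow_add hx0]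
        congr 2
        ring
      rw [lintegral_congr_ae h2, lintegral_moment hN le_rfl, add_zero]
  have hlog : Measurable fun x : I => -Real.log x := by fun_prop
  have hinv : Measurable fun x : I => ENNReal.ofReal (x : ℝ)⁻¹ := by fun_prop
  -- With s = -log x one has x ^ (t - 1) = x⁻¹ exp (-s t); the density x⁻¹ undoes the shift δ = 1.
  refine ⟨(M.withDensity fun x : I => ENNReal.ofReal (x : ℝ)⁻¹).map fun x : I => -Real.log x,
    inferInstance, ?_, fun t ht => ?_⟩
  · rw [ae_map_iff hlog.aemeasurable measurableSet_Ici]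
    exact Eventually.of_forall fun x => neg_nonneg.2 (Real.log_nonpos x.2.1 x.2.2)
  · have hl : ∫⁻ s, ENNReal.ofReal (Real.exp (-s * t))
        ∂((M.withDensity fun x : I => ENNReal.ofReal (x : ℝ)⁻¹).map fun x : I => -Real.log x) =
        ENNReal.ofReal (f t) := by
      rw [lintegral_map (by fun_prop) hlog,
        lintegral_withDensity_eq_lintegral_mul _ hinv (by fun_prop), ← key t ht]
      refine lintegral_congr_ae ?_
      filter_upwards [hM0] with x hx
      have hx0 : 0 < (x : ℝ) := lt_of_le_of_ne x.2.1 hx.symm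
      rw [Pi.mul_apply, ← ENNReal.ofReal_mul (inv_nonneg.2 x.2.1), neg_neg, ← Real.rpow_def_of_pos hx0,
        Real.rpow_sub hx0, Real.rpow_one]
      congr 1
      field_simp
    have hnn : ∀ s : ℝ, 0 ≤ Real.exp (-s * t) := fun s => (Real.exp_pos _).le
    constructor
    · refine ⟨by fun_prop, ?_⟩
      rw [hasFiniteIntegral_iff_ofReal (Eventually.of_forall hnn), hl]
      exact ENNReal.ofReal_lt_top
    · rw [integral_eq_lintegral_of_nonneg_ae (Eventually.of_forall hnn) (by fun_prop), hl,
        ENNReal.toReal_ofReal]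
      simpa using hf.nonneg 0 t ht

end IsCompletelyMonotone

end Bernstein

/-! ### Taylor remainders of exponentials and the integral representation of ψ -/

section TaylorKernel

/-- The remainder kernel `∫ u in 1..t, (t - u) ^ n / n! * exp (-s u)` of Taylor's formula at `1`. -/
noncomputable def taylorKernel (n : ℕ) (s t : ℝ) : ℝ :=
  ∫ u in (1 : ℝ)..t, (t - u) ^ n / (n.factorial : ℝ) * Real.exp (-s * u)

theorem continuous_taylorKernel (n : ℕ) : Continuous fun p : ℝ × ℝ => taylorKernel n p.1 p.2 := by
  unfold taylorKernel
  refine intervalIntegral.continuous_parametric_intervalIntegral_of_continuous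
    (f := fun (p : ℝ × ℝ) u => (p.2 - u) ^ n / (n.factorial : ℝ) * Real.exp (-p.1 * u)) ?_
    continuous_snd
  simp only [Function.uncurry_def]
  fun_prop

theorem taylorKernel_eq_neg_pow_mul (n : ℕ) (s t : ℝ) :
    taylorKernel n s t =
      (-1) ^ (n + 1) * ∫ u in t..1, (u - t) ^ n / (n.factorial : ℝ) * Real.exp (-s * u) := by
  unfold taylorKernel
  rw [intervalIntegral.integral_symm, ← intervalIntegral.integral_neg,
    ← intervalIntegral.integral_const_mul]
  refine intervalIntegral.integral_congr fun u _ => ?_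
  rw [← neg_sub u t, neg_pow]
  ring

theorem taylorKernel_nonneg (n : ℕ) (s : ℝ) {t : ℝ} (ht : 1 ≤ t) : 0 ≤ taylorKernel n s t :=
  intervalIntegral.integral_nonneg ht fun u hu => by
    have : 0 ≤ t - u := sub_nonneg.2 hu.2
    positivity

theorem taylorKernel_mono (n : ℕ) (s : ℝ) {t t' : ℝ} (ht : 1 ≤ t) (htt' : t ≤ t') :
    taylorKernel n s t ≤ taylorKernel n s t' := by
  have hi : ∀ a b c : ℝ, IntervalIntegrable
      (fun u => (a - u) ^ n / (n.factorial : ℝ) * Real.exp (-s * u)) volume b c := fun a b c =>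
    (by fun_prop : Continuous _).intervalIntegrable _ _
  unfold taylorKernel
  rw [← intervalIntegral.integral_add_adjacent_intervals (hi t' 1 t) (hi t' t t')]
  refine le_add_of_le_of_nonneg ?_ ?_
  · refine intervalIntegral.integral_mono_on ht (hi _ _ _) (hi _ _ _) fun u hu => ?_
    have : 0 ≤ t - u := sub_nonneg.2 hu.2
    gcongr
  · refine intervalIntegral.integral_nonneg htt' fun u hu => ?_
    have : 0 ≤ t' - u := sub_nonneg.2 hu.2
    positivity

theorem neg_pow_mul_taylorKernel (n : ℕ) (s t : ℝ) : (-1) ^ (n + 1) * taylorKernel n s t =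
    ∫ u in t..1, (u - t) ^ n / (n.factorial : ℝ) * Real.exp (-s * u) := by
  rw [taylorKernel_eq_neg_pow_mul, ← mul_assoc, ← mul_pow]
  simp

theorem neg_pow_mul_taylorKernel_nonneg (n : ℕ) (s : ℝ) {t : ℝ} (ht : t ≤ 1) :
    0 ≤ (-1) ^ (n + 1) * taylorKernel n s t := by
  rw [neg_pow_mul_taylorKernel]
  refine intervalIntegral.integral_nonneg ht fun u hu => ?_
  have : 0 ≤ u - t := sub_nonneg.2 hu.1
  positivity

/-- Makes |`taylorKernel n s 0`| a dominating function in the limit t → 0. -/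
theorem neg_pow_mul_taylorKernel_anti (n : ℕ) (s : ℝ) {t t' : ℝ} (htt' : t ≤ t') (ht : t' ≤ 1) :
    (-1) ^ (n + 1) * taylorKernel n s t' ≤ (-1) ^ (n + 1) * taylorKernel n s t := by
  have hi : ∀ a b c : ℝ, IntervalIntegrable
      (fun u => (u - a) ^ n / (n.factorial : ℝ) * Real.exp (-s * u)) volume b c := fun a b c =>
    (by fun_prop : Continuous _).intervalIntegrable _ _
  rw [neg_pow_mul_taylorKernel, neg_pow_mul_taylorKernel,
    ← intervalIntegral.integral_add_adjacent_intervals (hi t t t') (hi t t' 1)]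
  refine le_add_of_nonneg_of_le ?_ ?_
  · refine intervalIntegral.integral_nonneg htt' fun u hu => ?_
    have : 0 ≤ u - t := sub_nonneg.2 hu.1
    positivity
  · refine intervalIntegral.integral_mono_on ht (hi _ _ _) (hi _ _ _) fun u hu => ?_
    have : 0 ≤ u - t' := sub_nonneg.2 hu.1
    gcongr

/-- Substitute u = 2v - 1, the dilation about 1, and use exp (-s (2v - 1)) ≤ exp (-s v) for v ≥ 1.
The constant does not depend on s, so the bound survives integration against ν. -/
theorem taylorKernel_two_mul_sub_one_le (n : ℕ) {s : ℝ} (hs : 0 ≤ s) {t : ℝ} (ht : 1 ≤ t) :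
    taylorKernel n s (2 * t - 1) ≤ 2 ^ (n + 1) * taylorKernel n s t := by
  have h1 : taylorKernel n s (2 * t - 1) = 2 ^ (n + 1) * ∫ v in (1 : ℝ)..t,
      (t - v) ^ n / (n.factorial : ℝ) * Real.exp (-s * (2 * v - 1)) := by
    have h := intervalIntegral.integral_comp_mul_sub (a := 1) (b := t)
      (fun u => (2 * t - 1 - u) ^ n / (n.factorial : ℝ) * Real.exp (-s * u)) two_ne_zero 1
    rw [smul_eq_mul, show (2 : ℝ) * 1 - 1 = 1 by norm_num] at h
    unfold taylorKernel
    rw [eq_comm, inv_mul_eq_iff_eq_mul₀ two_ne_zero] at h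
    rw [h, pow_succ', mul_assoc, ← intervalIntegral.integral_const_mul (2 ^ n)]
    congr 1
    refine intervalIntegral.integral_congr fun v _ => ?_
    rw [show 2 * t - 1 - (2 * v - 1) = 2 * (t - v) by ring, mul_pow]
    ring
  rw [h1]
  unfold taylorKernel
  refine mul_le_mul_of_nonneg_left ?_ (by positivity)
  refine intervalIntegral.integral_mono_on ht ((by fun_prop : Continuous _).intervalIntegrable _ _)
    ((by fun_prop : Continuous _).intervalIntegrable _ _) fun v hv => ?_
  have : 0 ≤ t - v := sub_nonneg.2 hv.2
  gcongr ?_ * ?_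
  rw [Real.exp_le_exp]
  nlinarith [hv.1]

/-- The sign of `taylorKernel n s t` depends only on `n` and `t`. -/
theorem abs_taylorKernel (n : ℕ) (t : ℝ) :
    ∃ ε : ℝ, |ε| = 1 ∧ ∀ s, |taylorKernel n s t| = ε * taylorKernel n s t := by
  rcases le_total 1 t with h | h
  · exact ⟨1, abs_one, fun s => by rw [abs_of_nonneg (taylorKernel_nonneg n s h), one_mul]⟩
  · refine ⟨(-1) ^ (n + 1), by simp, fun s => ?_⟩
    rw [← abs_of_nonneg (neg_pow_mul_taylorKernel_nonneg n s h), abs_mul]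
    simp

theorem taylorKernel_zero (n : ℕ) (t : ℝ) :
    taylorKernel n 0 t = (t - 1) ^ (n + 1) / ((n + 1).factorial : ℝ) := by
  unfold taylorKernel
  simp only [neg_zero, zero_mul, Real.exp_zero, mul_one]
  rw [intervalIntegral.integral_div, intervalIntegral.integral_comp_sub_left (fun x => x ^ n) t]
  simp [integral_pow, Nat.factorial_succ]
  field_simp

theorem taylorKernel_of_ne_zero (n : ℕ) {s : ℝ} (hs : s ≠ 0) (t : ℝ) :
    taylorKernel n s t = ((-s) ^ (n + 1))⁻¹ * Real.exp (-s * t) -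
      ((-s) ^ (n + 1))⁻¹ * ∑ k ∈ Finset.range (n + 1),
        ((-s) ^ k * Real.exp (-s)) / (k.factorial : ℝ) * (t - 1) ^ k := by
  have hd : ∀ k : ℕ, iteratedDeriv k (fun u => Real.exp (-s * u)) =
      fun u => (-s) ^ k * Real.exp (-s * u) := fun k => iteratedDeriv_exp_const_mul k (-s)
  have h := taylor_formula (φ := fun u => Real.exp (-s * u)) (a := 1) (t := t) isOpen_univ
    (by fun_prop) (subset_univ _) n
  have h2 : ∫ u in (1 : ℝ)..t, (t - u) ^ n / (n.factorial : ℝ) *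
      iteratedDeriv (n + 1) (fun u => Real.exp (-s * u)) u =
      (-s) ^ (n + 1) * taylorKernel n s t := by
    unfold taylorKernel
    rw [← intervalIntegral.integral_const_mul]
    refine intervalIntegral.integral_congr fun u _ => ?_
    simp only [hd]
    ring
  rw [h2] at h
  simp only [hd, mul_one] at h
  have h0 : (-s) ^ (n + 1) ≠ 0 := pow_ne_zero _ (neg_ne_zero.2 hs)
  rw [h, mul_add, inv_mul_cancel_left₀ h0, add_sub_cancel_left]

/-- Modulo polynomials of degree at most `n + 1`, the kernel is a multiple of `exp (-s t)`. -/
theorem exists_polynomial_taylorKernel (n : ℕ) (s : ℝ) :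
    ∃ P : Polynomial ℝ, P.natDegree ≤ n + 1 ∧ ∀ t, taylorKernel n s t =
      (if s = 0 then 0 else ((-s) ^ (n + 1))⁻¹) * Real.exp (-s * t) + P.eval t := by
  have hX : ∀ k : ℕ, ((Polynomial.X - Polynomial.C (1 : ℝ)) ^ k).natDegree = k := fun k => by
    rw [Polynomial.natDegree_pow, Polynomial.natDegree_X_sub_C, mul_one]
  -- At s = 0 the kernel is itself a polynomial, of degree n + 1; this is why the degree bound is
  -- not n.
  rcases eq_or_ne s 0 with rfl | hs
  · refine ⟨Polynomial.C (((n + 1).factorial : ℝ)⁻¹) * (Polynomial.X - Polynomial.C (1 : ℝ)) ^ (n + 1),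
      (Polynomial.natDegree_C_mul_le _ _).trans (hX _).le, fun t => ?_⟩
    rw [taylorKernel_zero]
    simp [div_eq_inv_mul]
  · refine ⟨-(Polynomial.C ((-s) ^ (n + 1))⁻¹ * ∑ k ∈ Finset.range (n + 1),
      Polynomial.C (((-s) ^ k * Real.exp (-s)) / (k.factorial : ℝ)) *
        (Polynomial.X - Polynomial.C (1 : ℝ)) ^ k), ?_, fun t => ?_⟩
    · rw [Polynomial.natDegree_neg]
      refine (Polynomial.natDegree_C_mul_le _ _).trans
        (Polynomial.natDegree_sum_le_of_forall_le _ _ fun k hk => ?_)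
      refine (Polynomial.natDegree_C_mul_le _ _).trans ((hX k).le.trans ?_)
      exact (Finset.mem_range.1 hk).le
    · rw [taylorKernel_of_ne_zero n hs, if_neg hs]
      simp [Polynomial.eval_finsetSum, sub_eq_add_neg]

end TaylorKernel

/-- Taylor's formula for a function in `CM_(n+1)`, with remainder written as a mixture of the
remainders of the exponentials. -/
structure HasLaplaceTaylor (n : ℕ) (ψ : ℝ → ℝ) (ν : Measure ℝ) (T : Polynomial ℝ) : Prop where
  natDegree_le : T.natDegree ≤ n
  nonneg : ∀ᵐ s ∂ν, 0 ≤ s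
  integrable : ∀ t, 0 ≤ t → Integrable (fun s => taylorKernel n s t) ν
  eq : ∀ t, 0 ≤ t → ψ t = T.eval t + (-1) ^ (n + 1) * ∫ s, taylorKernel n s t ∂ν

-- The base point is 1 because derivatives of ψ may be unbounded near 0. For t > 0 the formula is
-- Fubini applied to Bernstein's representation of the derivative of order n + 1; t = 0 is reached
-- by continuity of ψ.
open Filter Topology in
theorem IsCM.exists_hasLaplaceTaylor {n : ℕ} {ψ : ℝ → ℝ} (hψ : IsCM (n + 1) ψ) :
    ∃ (ν : Measure ℝ) (T : Polynomial ℝ), SFinite ν ∧ HasLaplaceTaylor n ψ ν T := by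
  obtain ⟨ν, hνs, hν0, hν⟩ := hψ.completelyMonotone.exists_laplace
  set T : Polynomial ℝ := ∑ k ∈ Finset.range (n + 1),
    Polynomial.C (iteratedDeriv k ψ 1 / (k.factorial : ℝ)) *
      (Polynomial.X - Polynomial.C (1 : ℝ)) ^ k with hT
  have hTdeg : T.natDegree ≤ n := by
    refine Polynomial.natDegree_sum_le_of_forall_le _ _ fun k hk => ?_
    refine (Polynomial.natDegree_C_mul_le _ _).trans ?_
    rw [Polynomial.natDegree_pow, Polynomial.natDegree_X_sub_C, mul_one]
    exact Nat.lt_succ_iff.1 (Finset.mem_range.1 hk)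
  have hTeval : ∀ t, T.eval t = ∑ k ∈ Finset.range (n + 1),
      iteratedDeriv k ψ 1 / (k.factorial : ℝ) * (t - 1) ^ k := fun t => by
    simp [hT, Polynomial.eval_finsetSum]
  have hsq : ((-1 : ℝ) ^ (n + 1)) * (-1) ^ (n + 1) = 1 := by rw [← mul_pow]; simp
  have hpos : ∀ t, 0 < t → Integrable (fun s => taylorKernel n s t) ν ∧
      ψ t = T.eval t + (-1) ^ (n + 1) * ∫ s, taylorKernel n s t ∂ν := fun t ht => by
    have hsub := uIcc_subset_Ioi one_pos ht
    have hsub' : uIoc 1 t ⊆ Ioi 0 := uIoc_subset_uIcc.trans hsub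
    have hcont : ContinuousOn (fun u => ((-1 : ℝ) ^ (n + 1)) * iteratedDeriv (n + 1) ψ u)
        (uIcc 1 t) := ((continuousOn_iteratedDeriv_Ioi hψ.contDiffOn (n + 1)).mono hsub).const_smul
          ((-1 : ℝ) ^ (n + 1))
    have hprod : Integrable (fun p : ℝ × ℝ =>
        (t - p.1) ^ n / (n.factorial : ℝ) * Real.exp (-p.2 * p.1))
        ((volume.restrict (uIoc 1 t)).prod ν) := by
      rw [integrable_prod_iff (by fun_prop)]
      constructor
      · filter_upwards [ae_restrict_mem measurableSet_uIoc] with u hu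
        exact (hν u (hsub' hu)).1.const_mul _
      · have h1 : IntegrableOn (fun u => |(t - u) ^ n / (n.factorial : ℝ)| *
            (((-1 : ℝ) ^ (n + 1)) * iteratedDeriv (n + 1) ψ u)) (uIoc 1 t) := by
          refine (ContinuousOn.integrableOn_compact isCompact_uIcc ?_).mono_set uIoc_subset_uIcc
          fun_prop
        refine h1.congr ?_
        filter_upwards [ae_restrict_mem measurableSet_uIoc] with u hu
        rw [← (hν u (hsub' hu)).2, ← integral_const_mul]
        refine integral_congr_ae (Eventually.of_forall fun s => ?_)
        simp only [norm_mul, Real.norm_eq_abs, abs_of_pos (Real.exp_pos _)]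
    refine ⟨?_, ?_⟩
    · have h := hprod.integral_prod_right
      simp only at h
      have h2 := h.const_mul (if (1 : ℝ) ≤ t then 1 else -1)
      refine h2.congr (Eventually.of_forall fun s => ?_)
      simp only [taylorKernel, intervalIntegral.intervalIntegral_eq_integral_uIoc, smul_eq_mul]
    · rw [hTeval, taylor_formula isOpen_Ioi hψ.contDiffOn hsub n]
      congr 1
      have h1 : ∫ u in (1 : ℝ)..t, (t - u) ^ n / (n.factorial : ℝ) * iteratedDeriv (n + 1) ψ u =
          (-1) ^ (n + 1) * ∫ u in (1 : ℝ)..t, ∫ s,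
            (t - u) ^ n / (n.factorial : ℝ) * Real.exp (-s * u) ∂ν := by
        rw [← intervalIntegral.integral_const_mul]
        refine intervalIntegral.integral_congr fun u hu => ?_
        rw [integral_const_mul, (hν u (hsub hu)).2, mul_left_comm, ← mul_assoc ((-1 : ℝ) ^ (n + 1)),
          hsq, one_mul]
      rw [h1]
      congr 1
      simp only [taylorKernel, intervalIntegral.intervalIntegral_eq_integral_uIoc, smul_eq_mul]
      rw [integral_const_mul, integral_integral_swap hprod]
  have hcT : Continuous fun t => T.eval t := T.continuous
  have hKc := continuous_taylorKernel n
  have hseq : Tendsto (fun k : ℕ => 1 / ((k : ℝ) + 1)) atTop (𝓝 0) :=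
    tendsto_one_div_add_atTop_nhds_zero_nat
  have hseqpos : ∀ k : ℕ, 0 < 1 / ((k : ℝ) + 1) := fun k => by positivity
  have hK0 : ∀ s, Tendsto (fun k : ℕ => taylorKernel n s (1 / ((k : ℝ) + 1))) atTop
      (𝓝 (taylorKernel n s 0)) := fun s =>
    (hKc.comp (Continuous.prodMk_right s)).continuousAt.tendsto.comp hseq
  have hmeas : ∀ t, AEStronglyMeasurable (fun s => taylorKernel n s t) ν := fun t =>
    (hKc.comp (Continuous.prodMk_left t)).aestronglyMeasurable
  have hψ0 : Tendsto (fun k : ℕ => ψ (1 / ((k : ℝ) + 1))) atTop (𝓝 (ψ 0)) := by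
    have h := hψ.continuousOn.continuousWithinAt (x := 0) self_mem_Ici
    exact h.tendsto.comp (tendsto_nhdsWithin_iff.2
      ⟨hseq, Eventually.of_forall fun k => (hseqpos k).le⟩)
  have hlim : Tendsto (fun k : ℕ => ∫ s, taylorKernel n s (1 / ((k : ℝ) + 1)) ∂ν) atTop
      (𝓝 ((-1) ^ (n + 1) * (ψ 0 - T.eval 0))) := by
    refine ((hψ0.sub (hcT.continuousAt.tendsto.comp hseq)).const_mul ((-1) ^ (n + 1))).congr
      fun k => ?_
    simp only [Function.comp]
    rw [(hpos _ (hseqpos k)).2, add_sub_cancel_left, ← mul_assoc, hsq, one_mul]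
  have hbound : ∀ (k : ℕ) s, |taylorKernel n s (1 / ((k : ℝ) + 1))| ≤ |taylorKernel n s 0| :=
    fun k s => by
      have hk1 : 1 / ((k : ℝ) + 1) ≤ 1 := by
        rw [div_le_one (by positivity)]; linarith [k.cast_nonneg (α := ℝ)]
      have h1 := neg_pow_mul_taylorKernel_anti n s (hseqpos k).le hk1
      have h2 := neg_pow_mul_taylorKernel_nonneg n s hk1
      have h3 := abs_le_abs_of_nonneg h2 h1
      simpa [abs_mul] using h3
  -- Fatou's lemma: for each t the kernel has a sign independent of s, so its L¹ norm is the
  -- absolute value of its integral, and these converge by continuity of ψ at 0.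
  have hint0 : Integrable (fun s => taylorKernel n s 0) ν := by
    refine integrable_of_tendsto (Eventually.of_forall hK0) (fun k => hmeas _) ?_
    have h1 : ∀ k : ℕ, ∫⁻ s, ‖taylorKernel n s (1 / ((k : ℝ) + 1))‖ₑ ∂ν =
        ENNReal.ofReal |∫ s, taylorKernel n s (1 / ((k : ℝ) + 1)) ∂ν| := fun k => by
      obtain ⟨ε, hε, hεK⟩ := abs_taylorKernel n (1 / ((k : ℝ) + 1))
      have hi := (hpos _ (hseqpos k)).1
      have h2 : |∫ s, taylorKernel n s (1 / ((k : ℝ) + 1)) ∂ν| =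
          ∫ s, |taylorKernel n s (1 / ((k : ℝ) + 1))| ∂ν := by
        have h3 : ∫ s, |taylorKernel n s (1 / ((k : ℝ) + 1))| ∂ν =
            ε * ∫ s, taylorKernel n s (1 / ((k : ℝ) + 1)) ∂ν := by
          rw [← integral_const_mul]
          exact integral_congr_ae (Eventually.of_forall hεK)
        rw [← abs_of_nonneg (integral_nonneg fun s => abs_nonneg _), h3, abs_mul, hε, one_mul]
      rw [← ofReal_integral_norm_eq_lintegral_enorm hi, h2]
      rfl
    have h2 : Tendsto (fun k : ℕ => ENNReal.ofReal
        |∫ s, taylorKernel n s (1 / ((k : ℝ) + 1)) ∂ν|) atTop _ :=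
      (ENNReal.continuous_ofReal.tendsto _).comp hlim.abs
    simp_rw [h1]
    rw [h2.liminf_eq]
    exact ENNReal.ofReal_ne_top
  have heq0 : ∫ s, taylorKernel n s 0 ∂ν = (-1) ^ (n + 1) * (ψ 0 - T.eval 0) := by
    refine tendsto_nhds_unique (tendsto_integral_of_dominated_convergence
      (fun s => |taylorKernel n s 0|) (fun k => hmeas _) hint0.abs
      (fun k => Eventually.of_forall (hbound k)) (Eventually.of_forall hK0)) hlim
  refine ⟨ν, T, hνs, ⟨hTdeg, hν0, fun t ht => ?_, fun t ht => ?_⟩⟩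
  · rcases ht.eq_or_lt with rfl | ht
    · exact hint0
    · exact (hpos t ht).1
  · rcases ht.eq_or_lt with rfl | ht
    · rw [heq0, ← mul_assoc, hsq]; ring
    · exact (hpos t ht).2

/-! ### Growth and doubling estimates -/

theorem Polynomial.exists_abs_eval_le (T : Polynomial ℝ) {n : ℕ} (hT : T.natDegree ≤ n) :
    ∃ C : ℝ, 0 ≤ C ∧ ∀ t, 0 ≤ t → |T.eval t| ≤ C * (1 + t ^ n) := by
  refine ⟨∑ i ∈ Finset.range (n + 1), |T.coeff i|, by positivity, fun t ht => ?_⟩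
  rw [Polynomial.eval_eq_sum_range' (Nat.lt_succ_iff.2 hT), Finset.sum_mul]
  refine (Finset.abs_sum_le_sum_abs _ _).trans (Finset.sum_le_sum fun i hi => ?_)
  rw [abs_mul, abs_of_nonneg (pow_nonneg ht i)]
  refine mul_le_mul_of_nonneg_left ?_ (abs_nonneg _)
  rcases le_total t 1 with h | h
  · exact (pow_le_one₀ ht h).trans (le_add_of_nonneg_right (by positivity))
  · exact (pow_le_pow_right₀ h (Nat.lt_succ_iff.1 (Finset.mem_range.1 hi))).trans
      (le_add_of_nonneg_left zero_le_one)

namespace HasLaplaceTaylor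

variable {n : ℕ} {ψ : ℝ → ℝ} {ν : Measure ℝ} {T : Polynomial ℝ}

/-- The kernel keeps one sign as s varies. Pointwise inequalities between kernels thereby become
inequalities for |ψ - T|. -/
theorem integral_abs (h : HasLaplaceTaylor n ψ ν T) {t : ℝ} (ht : 0 ≤ t) :
    ∫ s, |taylorKernel n s t| ∂ν = |ψ t - T.eval t| := by
  obtain ⟨ε, hε, hεK⟩ := abs_taylorKernel n t
  have h1 : |ψ t - T.eval t| = |ε * ∫ s, taylorKernel n s t ∂ν| := by
    rw [h.eq t ht, add_sub_cancel_left, abs_mul, abs_mul, hε]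
    simp
  rw [h1, ← integral_const_mul]
  simp only [← hεK]
  rw [abs_of_nonneg (integral_nonneg fun s => abs_nonneg _)]

theorem abs_sub_mono (h : HasLaplaceTaylor n ψ ν T) {t t' : ℝ} (ht : 1 ≤ t) (htt' : t ≤ t') :
    |ψ t - T.eval t| ≤ |ψ t' - T.eval t'| := by
  have h0 : 0 ≤ t := zero_le_one.trans ht
  rw [← h.integral_abs h0, ← h.integral_abs (h0.trans htt')]
  refine integral_mono (h.integrable t h0).abs (h.integrable t' (h0.trans htt')).abs fun s => ?_
  exact abs_le_abs_of_nonneg (taylorKernel_nonneg n s ht) (taylorKernel_mono n s ht htt')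

theorem abs_sub_doubling (h : HasLaplaceTaylor n ψ ν T) {t : ℝ} (ht : 1 ≤ t) :
    |ψ (2 * t - 1) - T.eval (2 * t - 1)| ≤ 2 ^ (n + 1) * |ψ t - T.eval t| := by
  have h0 : 0 ≤ t := zero_le_one.trans ht
  have h1 : 1 ≤ 2 * t - 1 := by linarith
  rw [← h.integral_abs h0, ← h.integral_abs (zero_le_one.trans h1), ← integral_const_mul]
  refine integral_mono_ae (h.integrable _ (zero_le_one.trans h1)).abs
    ((h.integrable t h0).abs.const_mul _) ?_
  filter_upwards [h.nonneg] with s hs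
  rw [abs_of_nonneg (taylorKernel_nonneg n s h1), abs_of_nonneg (taylorKernel_nonneg n s ht)]
  exact taylorKernel_two_mul_sub_one_le n hs ht

/-- Growth comparison for a function in `CM_(n+1)` at comparable arguments. -/
theorem exists_growth_bound (h : HasLaplaceTaylor n ψ ν T) (hc : ContinuousOn ψ (Ici 0)) {c : ℝ}
    (hc0 : 0 ≤ c) :
    ∃ C : ℝ, ∀ t t' : ℝ, 0 ≤ t → 0 ≤ t' → t' ≤ 2 * t + c →
      |ψ t'| ≤ C * (1 + t ^ n + |ψ t|) ∧ |T.eval t'| ≤ C * (1 + t ^ n + |ψ t|) := by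
  obtain ⟨A, hA0, hA⟩ := T.exists_abs_eval_le h.natDegree_le
  set D : ℝ → ℝ := fun t => |ψ t - T.eval t| with hD
  obtain ⟨M, hM⟩ : ∃ M, ∀ t ∈ Icc 0 (2 * c + 3), D t ≤ M := by
    have hcont : ContinuousOn D (Icc 0 (2 * c + 3)) :=
      ((hc.mono Icc_subset_Ici_self).sub T.continuous.continuousOn).abs
    obtain ⟨M, hM⟩ := isCompact_Icc.bddAbove_image hcont
    exact ⟨M, fun t ht => hM (mem_image_of_mem _ ht)⟩
  have hM0 : 0 ≤ M := (abs_nonneg _).trans (hM 0 ⟨le_rfl, by positivity⟩)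
  have hDle : ∀ t t' : ℝ, 0 ≤ t → 0 ≤ t' → t' ≤ 2 * t + c → D t' ≤ M + 4 ^ (n + 1) * D t := by
    intro t t' ht ht' htt'
    have hDt : 0 ≤ 4 ^ (n + 1) * D t := by positivity
    rcases le_or_gt t' (2 * c + 3) with h1 | h1
    · exact (hM t' ⟨ht', h1⟩).trans (le_add_of_nonneg_right hDt)
    -- Here 2t > c + 3, so two applications of t ↦ 2t - 1 reach 4t - 3 ≥ 2t + c ≥ t'.
    · have ht1 : 1 ≤ t := by linarith
      have h2 := h.abs_sub_mono (t := t') (t' := 2 * (2 * t - 1) - 1) (by linarith) (by linarith)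
      have h3 := h.abs_sub_doubling (t := 2 * t - 1) (by linarith)
      have h4 := h.abs_sub_doubling ht1
      have h5 : (2 : ℝ) ^ (n + 1) * (2 ^ (n + 1) * D t) = 4 ^ (n + 1) * D t := by
        rw [← mul_assoc, ← mul_pow]; norm_num
      calc D t' ≤ 2 ^ (n + 1) * (2 ^ (n + 1) * D t) :=
            (h2.trans h3).trans (mul_le_mul_of_nonneg_left h4 (by positivity))
        _ = 4 ^ (n + 1) * D t := h5
        _ ≤ _ := le_add_of_nonneg_left hM0
  have hpow : ∀ t t' : ℝ, 0 ≤ t → 0 ≤ t' → t' ≤ 2 * t + c →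
      t' ^ n ≤ (2 ^ n * (2 ^ n + c ^ n)) * (1 + t ^ n) := by
    intro t t' ht ht' htt'
    have h1 : (2 * t + c) ^ n ≤ 2 ^ n * ((2 * t) ^ n + c ^ n) := by
      refine (add_pow_le (by positivity) hc0 n).trans ?_
      gcongr
      · norm_num
      · omega
    have h2 : 0 ≤ t ^ n := by positivity
    have h3 : 0 ≤ c ^ n := by positivity
    calc t' ^ n ≤ (2 * t + c) ^ n := by gcongr
      _ ≤ 2 ^ n * ((2 * t) ^ n + c ^ n) := h1
      _ ≤ 2 ^ n * ((2 ^ n + c ^ n) * (1 + t ^ n)) := by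
        gcongr
        rw [mul_pow]
        nlinarith [mul_nonneg h2 h3, pow_pos (two_pos : (0 : ℝ) < 2) n]
      _ = _ := by ring
  set B : ℝ := 2 ^ n * (2 ^ n + c ^ n) with hB
  have hB0 : 0 ≤ B := by positivity
  refine ⟨M + 4 ^ (n + 1) + 4 ^ (n + 1) * A + A * (1 + B), fun t t' ht ht' htt' => ?_⟩
  have h1 := hDle t t' ht ht' htt'
  have h2 := hA t ht
  have h3 := hA t' ht'
  have h4 := hpow t t' ht ht' htt'
  have h5 : D t ≤ |ψ t| + |T.eval t| := abs_sub _ _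
  have h6 : |ψ t'| ≤ D t' + |T.eval t'| := by
    have := abs_add_le (ψ t' - T.eval t') (T.eval t')
    simpa using this
  have h7 : 0 ≤ t ^ n := by positivity
  have h8 : A * (1 + t' ^ n) ≤ A * (1 + B) * (1 + t ^ n) := by
    rw [mul_assoc]
    gcongr
    nlinarith
  have h9 : (4 : ℝ) ^ (n + 1) * D t ≤ 4 ^ (n + 1) * (|ψ t| + A * (1 + t ^ n)) := by
    gcongr; linarith
  have h10 : 0 ≤ |ψ t| := abs_nonneg _
  have h11 : (0 : ℝ) ≤ 4 ^ (n + 1) := by positivity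
  have e1 : 0 ≤ M * (t ^ n + |ψ t|) := by positivity
  have e2 : (0 : ℝ) ≤ 4 ^ (n + 1) * (1 + t ^ n) := by positivity
  have e3 : (0 : ℝ) ≤ (4 ^ (n + 1) * A + A * (1 + B)) * |ψ t| := by positivity
  have e4 : 0 ≤ M * (1 + t ^ n + |ψ t|) := by positivity
  have e5 : (0 : ℝ) ≤ (4 ^ (n + 1) + 4 ^ (n + 1) * A) * (1 + t ^ n + |ψ t|) := by positivity
  have e6 : 0 ≤ A * (1 + B) * |ψ t| := by positivity
  constructor <;> linarith

end HasLaplaceTaylor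

universe u

/-! ### Positive definiteness of the Gaussian kernel -/

section GaussianKernel

variable {E : Type*} [NormedAddCommGroup E] [InnerProductSpace ℝ E]

theorem posSemidef_inner {X F : Type*} [NormedAddCommGroup F] [InnerProductSpace ℝ F]
    (v : X → F) : (Matrix.of fun x y : X => inner ℝ (v x) (v y)).PosSemidef := by
  refine ⟨by ext x y; simp [real_inner_comm], fun c => ?_⟩
  have h : (c.sum fun x a => c.sum fun y b => star a * inner ℝ (v x) (v y) * b) =
      ‖c.sum fun x a => a • v x‖ ^ 2 := by
    rw [← real_inner_self_eq_norm_sq]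
    simp only [Finsupp.sum, sum_inner, inner_sum, real_inner_smul_left, real_inner_smul_right,
      star_trivial]
    refine Finset.sum_congr rfl fun x _ => Finset.sum_congr rfl fun y _ => ?_
    rw [real_inner_comm]
    ring
  simp only [Matrix.of_apply]
  rw [h]
  positivity

theorem posSemidef_inner_pow (n : ℕ) :
    (Matrix.of fun x y : E => inner ℝ x y ^ n).PosSemidef := by
  induction n with
  | zero =>
    refine ⟨by ext; simp, fun c => ?_⟩
    simp only [pow_zero, Matrix.of_apply, star_trivial, mul_one]
    have : (c.sum fun _ a => c.sum fun _ b => a * b) = (c.sum fun _ a => a) ^ 2 := by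
      rw [sq, Finsupp.sum_mul]
      simp_rw [Finsupp.mul_sum]
    rw [this]
    positivity
  | succ n ih =>
    exact ih.hadamard (posSemidef_inner fun x : E => x)

theorem posSemidef_exp_inner {r : ℝ} (hr : 0 ≤ r) :
    (Matrix.of fun x y : E => Real.exp (r * inner ℝ x y)).PosSemidef := by
  refine ⟨?_, fun c => ?_⟩
  · ext x y
    simp [real_inner_comm]
  · have hs : HasSum (fun n : ℕ => c.sum fun x a => c.sum fun y b =>
        star a * (r ^ n / (n.factorial : ℝ) * inner ℝ x y ^ n) * b)
        (c.sum fun x a => c.sum fun y b => star a * Real.exp (r * inner ℝ x y) * b) := by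
      simp only [Finsupp.sum]
      refine hasSum_sum fun x _ => hasSum_sum fun y _ => ?_
      refine HasSum.mul_right _ (HasSum.mul_left _ ?_)
      have := NormedSpace.expSeries_div_hasSum_exp (r * inner ℝ x y)
      rw [← Real.exp_eq_exp_ℝ] at this
      convert! this using 2 with n
      rw [mul_pow]; ring
    refine hs.nonneg fun n => ?_
    have h := (posSemidef_inner_pow (E := E) n).2 c
    have h2 : (c.sum fun x a => c.sum fun y b =>
        star a * (r ^ n / (n.factorial : ℝ) * inner ℝ x y ^ n) * b) = r ^ n / (n.factorial : ℝ) *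
        (c.sum fun x a => c.sum fun y b => star a * (inner ℝ x y ^ n) * b) := by
      simp only [Finsupp.sum, Finset.mul_sum]
      refine Finset.sum_congr rfl fun x _ => Finset.sum_congr rfl fun y _ => ?_
      ring
    rw [h2]
    exact mul_nonneg (by positivity) h

/-- The kernel factors as exp (-s‖x‖²) exp (-s‖y‖²) exp (2s⟨x, y⟩): a rank-one kernel times a power
series in the inner product with nonnegative coefficients. Schur products preserve positivity. -/
theorem posSemidef_gaussian {s : ℝ} (hs : 0 ≤ s) :
    (Matrix.of fun x y : E => Real.exp (-s * ‖x - y‖ ^ 2)).PosSemidef := by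
  have h1 : (Matrix.of fun x y : E =>
      Real.exp (-s * ‖x‖ ^ 2) * Real.exp (-s * ‖y‖ ^ 2)).PosSemidef := by
    convert! posSemidef_inner (fun x : E => Real.exp (-s * ‖x‖ ^ 2)) using 1
    ext x y
    simp [mul_comm]
  convert! h1.hadamard (posSemidef_exp_inner (E := E) (r := 2 * s) (by positivity)) using 1
  ext x y
  simp only [Matrix.of_apply, Matrix.hadamard_apply, ← Real.exp_add]
  congr 1
  rw [norm_sub_sq_real]
  ring

/-- A continuous feature map for the Gaussian kernel `exp (-s ‖x - y‖ ^ 2)`. -/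
theorem exists_gaussian_feature {E : Type u} [NormedAddCommGroup E] [InnerProductSpace ℝ E]
    {s : ℝ} (hs : 0 ≤ s) :
    ∃ (V : Type u) (_ : NormedAddCommGroup V) (_ : InnerProductSpace ℝ V) (_ : CompleteSpace V)
      (Φ : E → V), Continuous Φ ∧ ∀ x y, inner ℝ (Φ x) (Φ y) = Real.exp (-s * ‖x - y‖ ^ 2) := by
  let K : Matrix E E (ℝ →L[ℝ] ℝ) :=
    .of fun x y => Real.exp (-s * ‖x - y‖ ^ 2) • (1 : ℝ →L[ℝ] ℝ)
  have hK : K.PosSemidef := by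
    have h02 := (RKHS.posSemidef_tfae (K := K)).out 0 2
    refine h02.mpr ⟨?_, fun c => ?_⟩
    · ext x y
      simp [K, Matrix.conjTranspose_apply, norm_sub_rev y x]
    · have h := (posSemidef_gaussian (E := E) hs).2 c
      simp only [K, Matrix.of_apply, star_trivial] at h ⊢
      rw [Finsupp.sum_comm]
      convert! h using 1
      simp only [RCLike.re_to_real]
      refine Finsupp.sum_congr fun x _ => Finsupp.sum_congr fun y _ => ?_
      simp
      ring
  have : Fact K.PosSemidef := ⟨hK⟩
  let Φ : E → RKHS.OfKernel K := fun x => RKHS.kerFun (RKHS.OfKernel K) x (1 : ℝ)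
  have hin : ∀ x y, inner ℝ (Φ x) (Φ y) = Real.exp (-s * ‖x - y‖ ^ 2) := fun x y => by
    have := RKHS.kernel_inner (RKHS.OfKernel K) y x (1 : ℝ) (1 : ℝ)
    rw [RKHS.OfKernel.kernel_ofKernel] at this
    rw [← this]
    simp [K, norm_sub_rev y x]
  refine ⟨RKHS.OfKernel K, inferInstance, inferInstance, inferInstance, Φ, ?_, hin⟩
  rw [continuous_iff_continuousAt]
  intro y
  rw [ContinuousAt, tendsto_iff_norm_sub_tendsto_zero]
  have h : ∀ x, ‖Φ x - Φ y‖ = √(2 - 2 * Real.exp (-s * ‖x - y‖ ^ 2)) := fun x => by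
    rw [← Real.sqrt_sq (norm_nonneg (Φ x - Φ y)), norm_sub_sq_real, hin,
      ← real_inner_self_eq_norm_sq (Φ x), ← real_inner_self_eq_norm_sq (Φ y), hin, hin]
    simp only [sub_self, norm_zero]
    congr 1
    norm_num
    ring
  simp_rw [h]
  have hc : Continuous fun x : E => √(2 - 2 * Real.exp (-s * ‖x - y‖ ^ 2)) := by fun_prop
  simpa using hc.tendsto y

end GaussianKernel

/-! ### Gaussian potentials determine a density -/

section Uniqueness

theorem exp_neg_mul_norm_sub_sq {E : Type*} [NormedAddCommGroup E] [InnerProductSpace ℝ E]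
    (s : ℝ) (x y : E) : Real.exp (-s * ‖x - y‖ ^ 2) =
    Real.exp (-s * ‖y‖ ^ 2) * (Real.exp (inner ℝ x ((2 * s) • y)) * Real.exp (-s * ‖x‖ ^ 2)) := by
  rw [← Real.exp_add, ← Real.exp_add, norm_sub_sq_real, real_inner_smul_right]
  congr 1
  ring

theorem integrable_gaussian_mul {E : Type*} [NormedAddCommGroup E]
    [SecondCountableTopology E] [MeasurableSpace E] [BorelSpace E] {ρ : Measure E}
    [IsFiniteMeasure ρ] {g : E → ℝ}
    (hg : Integrable g ρ) {s : ℝ} (hs : 0 ≤ s) (y : E) :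
    Integrable (fun x => Real.exp (-s * ‖x - y‖ ^ 2) * g x) ρ := by
  refine hg.bdd_mul (c := 1) (by fun_prop) (Filter.Eventually.of_forall fun x => ?_)
  rw [Real.norm_of_nonneg (Real.exp_pos _).le, Real.exp_le_one_iff]
  nlinarith [mul_nonneg hs (sq_nonneg ‖x - y‖)]

variable {E : Type*} [NormedAddCommGroup E] [InnerProductSpace ℝ E] [CompleteSpace E]
  [SecondCountableTopology E] [MeasurableSpace E] [BorelSpace E]

open ProbabilityTheory Complex in
/-- Finite measures whose moment generating functions are finite and agree are equal. -/
theorem measure_ext_of_integral_exp_inner {P Q : Measure E} [IsFiniteMeasure P] [IsFiniteMeasure Q]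
    (hP : ∀ v : E, Integrable (fun x => Real.exp (inner ℝ x v)) P)
    (h : ∀ v : E, ∫ x, Real.exp (inner ℝ x v) ∂P = ∫ x, Real.exp (inner ℝ x v) ∂Q) : P = Q := by
  refine Measure.ext_of_charFun (funext fun v => ?_)
  -- Every one-dimensional marginal has a moment generating function finite on all of ℝ, so equality
  -- extends to complex arguments; the argument `I` gives the characteristic function.
  have hset : integrableExpSet (fun x : E => inner ℝ x v) P = univ := by
    refine eq_univ_of_forall fun t => ?_
    have := hP (t • v)
    simpa [integrableExpSet, real_inner_smul_right] using this
  have hmgf : mgf (fun x : E => inner ℝ x v) P = mgf (fun x : E => inner ℝ x v) Q := by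
    funext t
    have := h (t • v)
    simpa [mgf, real_inner_smul_right] using this
  have hzero : P = 0 ↔ Q = 0 := by
    have h0 := h 0
    simp only [inner_zero_right, Real.exp_zero, integral_const, smul_eq_mul, mul_one] at h0
    rw [← Measure.measure_univ_eq_zero, ← Measure.measure_univ_eq_zero (μ := Q),
      ← measureReal_eq_zero_iff, ← measureReal_eq_zero_iff, h0]
  have key := eqOn_complexMGF_of_mgf' hmgf hzero (x := I) (by simp [hset])
  simp only [complexMGF] at key
  simp only [charFun_apply]
  simp_rw [mul_comm _ I]
  exact key

/-- The positive and negative parts of G are densities of two finite measures with the same moment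
generating function. -/
theorem ae_eq_zero_of_integral_exp_inner_mul {ρ : Measure E} {G : E → ℝ} (hG : Measurable G)
    (hint : ∀ v : E, Integrable (fun x => Real.exp (inner ℝ x v) * G x) ρ)
    (h : ∀ v : E, ∫ x, Real.exp (inner ℝ x v) * G x ∂ρ = 0) : G =ᵐ[ρ] 0 := by
  have hmeas : ∀ F : E → ℝ, Measurable F → Measurable fun x => ENNReal.ofReal (max (F x) 0) :=
    fun F hF => (hF.max measurable_const).ennreal_ofReal
  have hint' : ∀ F : E → ℝ, Measurable F →
      (∀ v : E, Integrable (fun x => Real.exp (inner ℝ x v) * F x) ρ) →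
      ∀ v : E, Integrable (fun x => max (F x) 0 * Real.exp (inner ℝ x v)) ρ := fun F hF hi v => by
    refine (hi v).mono (by fun_prop) (Filter.Eventually.of_forall fun x => ?_)
    rw [norm_mul, norm_mul, mul_comm]
    gcongr
    rw [Real.norm_of_nonneg (le_max_right _ _)]
    exact max_le (le_abs_self _) (abs_nonneg _)
  have hfin : ∀ F : E → ℝ, Measurable F →
      (∀ v : E, Integrable (fun x => Real.exp (inner ℝ x v) * F x) ρ) →
      IsFiniteMeasure (ρ.withDensity fun x => ENNReal.ofReal (max (F x) 0)) := fun F hF hi => by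
    refine isFiniteMeasure_withDensity_ofReal ?_
    simpa using (hint' F hF hi 0).2
  have heval : ∀ F : E → ℝ, Measurable F → ∀ v : E,
      ∫ x, Real.exp (inner ℝ x v) ∂(ρ.withDensity fun x => ENNReal.ofReal (max (F x) 0)) =
        ∫ x, max (F x) 0 * Real.exp (inner ℝ x v) ∂ρ := fun F hF v => by
    rw [integral_withDensity_eq_integral_toReal_smul (hmeas F hF)
      (Filter.Eventually.of_forall fun x => ENNReal.ofReal_lt_top)]
    simp_rw [ENNReal.toReal_ofReal (le_max_right _ _), smul_eq_mul]
  have hneg : ∀ v : E, Integrable (fun x => Real.exp (inner ℝ x v) * (-G) x) ρ := fun v => by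
    simpa using (hint v).neg
  have := hfin G hG hint
  have := hfin (-G) hG.neg hneg
  have hPQ : (ρ.withDensity fun x => ENNReal.ofReal (max (G x) 0)) =
      ρ.withDensity fun x => ENNReal.ofReal (max ((-G) x) 0) := by
    refine measure_ext_of_integral_exp_inner (fun v => ?_) fun v => ?_
    · rw [integrable_withDensity_iff (hmeas G hG)
        (Filter.Eventually.of_forall fun x => ENNReal.ofReal_lt_top)]
      simp_rw [ENNReal.toReal_ofReal (le_max_right _ _), mul_comm _ (max _ _)]
      exact hint' G hG hint v
    · rw [heval G hG, heval (-G) hG.neg, ← sub_eq_zero,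
        ← integral_sub (hint' G hG hint v) (hint' (-G) hG.neg hneg v)]
      refine Eq.trans ?_ (h v)
      refine integral_congr_ae (Filter.Eventually.of_forall fun x => ?_)
      simp only [Pi.neg_apply]
      rw [← sub_mul, max_zero_sub_eq_self, mul_comm]
  rw [withDensity_eq_iff (hmeas G hG).aemeasurable (hmeas _ hG.neg).aemeasurable] at hPQ
  · filter_upwards [hPQ] with x hx
    rw [ENNReal.ofReal_eq_ofReal_iff (le_max_right _ _) (le_max_right _ _)] at hx
    rw [← max_zero_sub_eq_self (G x), hx]
    simp
  · rw [← setLIntegral_univ, ← withDensity_apply _ MeasurableSet.univ]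
    exact measure_ne_top _ _

/-- Gaussian potentials determine finite signed measures. -/
theorem ae_eq_zero_of_integral_gaussian_mul {ρ : Measure E} [IsFiniteMeasure ρ] {g : E → ℝ}
    (hg : Measurable g) (hgi : Integrable g ρ) {s : ℝ} (hs : 0 < s)
    (h : ∀ y : E, ∫ x, Real.exp (-s * ‖x - y‖ ^ 2) * g x ∂ρ = 0) : g =ᵐ[ρ] 0 := by
  -- Completing the square with y = v / (2s). The weight exp (-s‖x‖²) makes all exponential moments
  -- finite, which g alone need not have.
  have hkey : ∀ v x : E, Real.exp (inner ℝ x v) * (Real.exp (-s * ‖x‖ ^ 2) * g x) =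
      Real.exp (s * ‖(2 * s)⁻¹ • v‖ ^ 2) *
        (Real.exp (-s * ‖x - (2 * s)⁻¹ • v‖ ^ 2) * g x) := fun v x => by
    rw [exp_neg_mul_norm_sub_sq s x, smul_inv_smul₀ (by positivity), ← mul_assoc, ← mul_assoc,
      ← mul_assoc, ← Real.exp_add (s * _)]
    simp
  have h1 : (fun x => Real.exp (-s * ‖x‖ ^ 2) * g x) =ᵐ[ρ] 0 := by
    refine ae_eq_zero_of_integral_exp_inner_mul (by fun_prop) (fun v => ?_) fun v => ?_
    · simp_rw [hkey]
      exact (integrable_gaussian_mul hgi hs.le _).const_mul _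
    · simp_rw [hkey]
      rw [integral_const_mul, h, mul_zero]
  filter_upwards [h1] with x hx
  simpa [(Real.exp_pos _).ne'] using hx

end Uniqueness

/-! ### Finite differences -/

section FiniteDifference

open Filter Topology

/-- The coefficients of the `m`-th forward difference. -/
def diffCoeff (m i : ℕ) : ℝ := (-1) ^ (m - i) * m.choose i

theorem fwdDiff_iter_eq_sum_diffCoeff {M : Type*} [AddCommMonoid M] (h : M) (f : M → ℝ) (m : ℕ)
    (y : M) : (fwdDiff h)^[m] f y = ∑ i ∈ Finset.range (m + 1), diffCoeff m i * f (y + i • h) := by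
  rw [fwdDiff_iter_eq_sum_shift]
  simp [diffCoeff]

theorem sum_diffCoeff_mul_eval {P : Polynomial ℝ} {m : ℕ} (hP : P.natDegree < m) :
    ∑ i ∈ Finset.range (m + 1), diffCoeff m i * P.eval (i : ℝ) = 0 := by
  have h := fwdDiff_iter_eq_sum_diffCoeff (1 : ℝ) (fun t => P.eval t) m 0
  rw [Polynomial.fwdDiff_iter_eq_zero_of_degree_lt hP] at h
  simpa using h.symm

/-- By induction on m the first difference, which also tends to 0, vanishes; so the sequence is
constant, equal to its limit 0. -/
theorem eq_zero_of_fwdDiff_iter_eq_zero {m : ℕ} {a : ℕ → ℝ} (h : (fwdDiff 1)^[m] a = 0)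
    (ha : Tendsto a atTop (𝓝 0)) : a = 0 := by
  induction m generalizing a with
  | zero => simpa using h
  | succ m ih =>
    rw [Function.iterate_succ_apply] at h
    have hd := ((tendsto_add_atTop_iff_nat 1).2 ha).sub ha
    rw [sub_zero] at hd
    have h1 : fwdDiff 1 a = 0 := ih h hd
    have h2 : ∀ k, a k = a 0 := fun k => by
      induction k with
      | zero => rfl
      | succ k ihk => rw [← ihk, ← sub_eq_zero]; exact congrFun h1 k
    have h3 : a 0 = 0 := tendsto_nhds_unique (tendsto_const_nhds.congr fun k => (h2 k).symm) ha
    funext k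
    rw [h2, h3]; rfl

theorem eq_zero_of_sum_diffCoeff {m : ℕ} {a : ℕ → ℝ}
    (h : ∀ k, ∑ i ∈ Finset.range (m + 1), diffCoeff m i * a (k + i) = 0)
    (ha : Tendsto a atTop (𝓝 0)) : a = 0 := by
  refine eq_zero_of_fwdDiff_iter_eq_zero (m := m) (funext fun k => ?_) ha
  rw [fwdDiff_iter_eq_sum_diffCoeff]
  simpa using h k

end FiniteDifference

/-! ### The differenced Gaussian energy -/

section Core

theorem integrable_mul_prod {X : Type*} [MeasurableSpace X] {ρ : Measure X}
    [IsFiniteMeasure ρ] {g : X → ℝ} (hg : Measurable g)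
    (hg1 : ∀ x, |g x| ≤ 1) {F : X × X → ℝ} (hF : Integrable F (ρ.prod ρ)) :
    Integrable (fun p => F p * (g p.1 * g p.2)) (ρ.prod ρ) := by
  refine hF.mul_bdd (c := 1) (by fun_prop) (Filter.Eventually.of_forall fun p => ?_)
  rw [norm_mul]
  exact mul_le_one₀ (hg1 _) (norm_nonneg _) (hg1 _)

variable {E : Type*} [NormedAddCommGroup E] [InnerProductSpace ℝ E]

/-- Squared distance of the translates `x - i e` and `y - j e`. -/
def shiftSqDist (e : E) (i j : ℕ) (p : E × E) : ℝ :=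
  ‖(p.1 - (i : ℝ) • e) - (p.2 - (j : ℝ) • e)‖ ^ 2

theorem shiftSqDist_nonneg (e : E) (i j : ℕ) (p : E × E) : 0 ≤ shiftSqDist e i j p := sq_nonneg _

theorem continuous_shiftSqDist (e : E) (i j : ℕ) : Continuous (shiftSqDist e i j) := by
  unfold shiftSqDist
  fun_prop

theorem shiftSqDist_le (e : E) (i j : ℕ) (p : E × E) :
    shiftSqDist e i j p ≤ 2 * ‖p.1 - p.2‖ ^ 2 + 2 * ‖((j : ℝ) - i) • e‖ ^ 2 := by
  have h : (p.1 - (i : ℝ) • e) - (p.2 - (j : ℝ) • e) = (p.1 - p.2) + ((j : ℝ) - i) • e := by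
    rw [sub_smul]; abel
  rw [shiftSqDist, h]
  have h1 := parallelogram_law_with_norm ℝ (p.1 - p.2) (((j : ℝ) - i) • e)
  nlinarith [sq_nonneg ‖(p.1 - p.2) - ((j : ℝ) - i) • e‖]

/-- For fixed j the squared distance is quadratic in i, so its image under P is a polynomial in i of
degree at most 2d < m, which the m-th difference annihilates. -/
theorem sum_diffCoeff_mul_eval_shiftSqDist {P : Polynomial ℝ} {d m : ℕ} (hP : P.natDegree ≤ d)
    (hm : 2 * d < m) (e : E) (p : E × E) :
    ∑ j ∈ Finset.range (m + 1), ∑ i ∈ Finset.range (m + 1),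
      diffCoeff m i * diffCoeff m j * P.eval (shiftSqDist e i j p) = 0 := by
  refine Finset.sum_eq_zero fun j _ => ?_
  set w : E := p.1 - (p.2 - (j : ℝ) • e) with hw
  set q : Polynomial ℝ := Polynomial.C (‖e‖ ^ 2) * Polynomial.X ^ 2 +
    Polynomial.C (-2 * inner ℝ w e) * Polynomial.X + Polynomial.C (‖w‖ ^ 2) with hq
  have hqd : q.natDegree ≤ 2 := Polynomial.natDegree_quadratic_le
  have hPq : (P.comp q).natDegree < m := by
    refine lt_of_le_of_lt Polynomial.natDegree_comp_le (lt_of_le_of_lt ?_ hm)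
    rw [mul_comm]
    exact Nat.mul_le_mul hqd hP
  have heval : ∀ i : ℕ, (P.comp q).eval (i : ℝ) = P.eval (shiftSqDist e i j p) := fun i => by
    rw [Polynomial.eval_comp]
    congr 1
    have h : (p.1 - (i : ℝ) • e) - (p.2 - (j : ℝ) • e) = w - (i : ℝ) • e := by rw [hw]; abel
    rw [shiftSqDist, h, norm_sub_sq_real, real_inner_smul_right, norm_smul, mul_pow]
    simp [hq]
    ring
  have h := sum_diffCoeff_mul_eval hPq
  simp_rw [heval] at h
  calc _ = diffCoeff m j * ∑ i ∈ Finset.range (m + 1),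
        diffCoeff m i * P.eval (shiftSqDist e i j p) := by
        rw [Finset.mul_sum]
        exact Finset.sum_congr rfl fun i _ => by ring
    _ = 0 := by rw [h, mul_zero]

variable [MeasurableSpace E]

/-- The quadratic form of the differenced Gaussian kernel. -/
noncomputable def gaussianForm (ρ : Measure E) (g : E → ℝ) (e : E) (m : ℕ) (s : ℝ) : ℝ :=
  ∑ j ∈ Finset.range (m + 1), ∑ i ∈ Finset.range (m + 1), diffCoeff m i * diffCoeff m j *
    ∫ p, Real.exp (-s * shiftSqDist e i j p) * (g p.1 * g p.2) ∂(ρ.prod ρ)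

variable [SecondCountableTopology E] [BorelSpace E]

theorem integrable_exp_shiftSqDist {ρ : Measure E} [IsFiniteMeasure ρ] {s : ℝ} (hs : 0 ≤ s) (e : E)
    (i j : ℕ) : Integrable (fun p => Real.exp (-s * shiftSqDist e i j p)) (ρ.prod ρ) := by
  have := continuous_shiftSqDist e i j
  refine (integrable_const (1 : ℝ)).mono (by fun_prop) (Filter.Eventually.of_forall fun p => ?_)
  rw [Real.norm_of_nonneg (Real.exp_pos _).le, norm_one, Real.exp_le_one_iff]
  nlinarith [mul_nonneg hs (shiftSqDist_nonneg e i j p)]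

variable [CompleteSpace E]

-- Let Φ be a Gaussian feature map and v i the ρ-integral of g x • Φ (x - i e). The form is the
-- squared norm of the combination of the v i with weights `diffCoeff m i`. If that combination is
-- zero, pairing it with Φ y shows that the Gaussian potential of gρ has zero m-th difference in
-- direction e; as it decays along y + k e, it vanishes.
open Filter Topology in
theorem gaussianForm_nonneg_and_ae_eq_zero {ρ : Measure E} [IsFiniteMeasure ρ] {g : E → ℝ} (hg : Measurable g)
    (hg1 : ∀ x, |g x| ≤ 1) {e : E} (he : e ≠ 0) (m : ℕ) {s : ℝ} (hs : 0 < s) :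
    0 ≤ gaussianForm ρ g e m s ∧ (gaussianForm ρ g e m s = 0 → g =ᵐ[ρ] 0) := by
  obtain ⟨V, _, _, _, Φ, hΦ, hin⟩ := exists_gaussian_feature (E := E) hs.le
  have hgi : Integrable g ρ := (integrable_const (1 : ℝ)).mono hg.aestronglyMeasurable
    (Eventually.of_forall fun x => by simpa using hg1 x)
  have hΦ1 : ∀ x, ‖Φ x‖ = 1 := fun x => by
    have h := hin x x
    rw [real_inner_self_eq_norm_sq] at h
    simp only [sub_self, norm_zero] at h
    norm_num at h
    rcases h with h | h
    · exact h
    · linarith [norm_nonneg (Φ x)]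
  have hint : ∀ i : ℕ, Integrable (fun x => g x • Φ (x - (i : ℝ) • e)) ρ := fun i => by
    exact hgi.smul_bdd 1 (hΦ.comp (by fun_prop)).aestronglyMeasurable
      (Eventually.of_forall fun x => (hΦ1 _).le)
  set v : ℕ → V := fun i => ∫ x, g x • Φ (x - (i : ℝ) • e) ∂ρ with hv
  have hvv : ∀ i j, inner ℝ (v i) (v j) =
      ∫ p, Real.exp (-s * shiftSqDist e i j p) * (g p.1 * g p.2) ∂(ρ.prod ρ) := fun i j => by
    rw [integral_prod _ (integrable_mul_prod hg hg1 (integrable_exp_shiftSqDist hs.le e i j)),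
      real_inner_comm, hv]
    simp only
    rw [← integral_inner (hint i)]
    refine integral_congr_ae (Eventually.of_forall fun x => ?_)
    simp only
    rw [real_inner_comm, ← integral_inner (hint j)]
    refine integral_congr_ae (Eventually.of_forall fun y => ?_)
    simp only
    rw [real_inner_smul_left, real_inner_smul_right, hin, shiftSqDist]
    ring
  have hform : gaussianForm ρ g e m s =
      ‖∑ i ∈ Finset.range (m + 1), diffCoeff m i • v i‖ ^ 2 := by
    rw [← real_inner_self_eq_norm_sq, gaussianForm, inner_sum]
    refine Finset.sum_congr rfl fun j _ => ?_
    rw [sum_inner]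
    refine Finset.sum_congr rfl fun i _ => ?_
    rw [← hvv, real_inner_smul_left, real_inner_smul_right]
    ring
  refine ⟨by rw [hform]; positivity, fun h0 => ?_⟩
  rw [hform, sq_eq_zero_iff, norm_eq_zero] at h0
  set N : E → ℝ := fun y => ∫ x, Real.exp (-s * ‖x - y‖ ^ 2) * g x ∂ρ with hN
  have hNv : ∀ (i : ℕ) (y : E), inner ℝ (Φ y) (v i) = N (y + (i : ℝ) • e) := fun i y => by
    simp only [hv, hN]
    rw [← integral_inner (hint i)]
    refine integral_congr_ae (Eventually.of_forall fun x => ?_)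
    simp only
    rw [real_inner_smul_right, hin, norm_sub_rev, mul_comm,
      show x - (i : ℝ) • e - y = x - (y + (i : ℝ) • e) by abel]
  have hsum : ∀ y, ∑ i ∈ Finset.range (m + 1), diffCoeff m i * N (y + (i : ℝ) • e) = 0 := fun y => by
    have h := congrArg (fun u => inner ℝ (Φ y) u) h0
    simp only [inner_sum, real_inner_smul_right, inner_zero_right, hNv] at h
    exact h
  refine ae_eq_zero_of_integral_gaussian_mul hg hgi hs fun y => ?_
  have hlim : Tendsto (fun k : ℕ => N (y + (k : ℝ) • e)) atTop (𝓝 0) := by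
    have h0 : (0 : ℝ) = ∫ _, (0 : ℝ) ∂ρ := by simp
    rw [h0]
    refine tendsto_integral_of_dominated_convergence (fun _ => 1) (fun k => by fun_prop)
      (integrable_const _) (fun k => Eventually.of_forall fun x => ?_)
      (Eventually.of_forall fun x => ?_)
    · rw [norm_mul, Real.norm_of_nonneg (Real.exp_pos _).le]
      refine mul_le_one₀ ?_ (norm_nonneg _) (hg1 x)
      rw [Real.exp_le_one_iff]
      nlinarith [mul_nonneg hs.le (sq_nonneg ‖x - (y + (k : ℝ) • e)‖)]
    · have h1 : Tendsto (fun k : ℕ => ‖x - (y + (k : ℝ) • e)‖) atTop atTop := by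
        have h2 : Tendsto (fun k : ℕ => (k : ℝ) * ‖e‖ - ‖x - y‖) atTop atTop :=
          tendsto_atTop_add_const_right _ _
            (tendsto_natCast_atTop_atTop.atTop_mul_const (norm_pos_iff.2 he))
        refine tendsto_atTop_mono (fun k => ?_) h2
        have h3 : ‖(k : ℝ) • e‖ = k * ‖e‖ := by rw [norm_smul]; simp
        rw [← h3, ← sub_sub, ← norm_neg (x - y - (k : ℝ) • e), neg_sub]
        exact norm_sub_norm_le _ _
      have h4 : Tendsto (fun k : ℕ => s * ‖x - (y + (k : ℝ) • e)‖ ^ 2) atTop atTop :=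
        ((tendsto_pow_atTop two_ne_zero).comp h1).const_mul_atTop hs
      have h5 := (Real.tendsto_exp_neg_atTop_nhds_zero.comp h4).mul_const (g x)
      simpa [neg_mul] using h5
  have ha := eq_zero_of_sum_diffCoeff (m := m) (a := fun k : ℕ => N (y + (k : ℝ) • e))
    (fun k => by
      rw [← hsum (y + (k : ℝ) • e)]
      refine Finset.sum_congr rfl fun i _ => ?_
      rw [Nat.cast_add, add_smul, add_assoc]) hlim
  have h0 := congrFun ha 0
  simp only [Nat.cast_zero, zero_smul, add_zero] at h0
  exact h0

end Core

/-! ### Injectivity on a separable space -/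

section Core

variable {E : Type*} [NormedAddCommGroup E] [InnerProductSpace ℝ E] [CompleteSpace E]
  [SecondCountableTopology E] [MeasurableSpace E] [BorelSpace E]

theorem integrable_norm_sub_pow {F : Type*} [NormedAddCommGroup F] [SecondCountableTopology F]
    [MeasurableSpace F] [BorelSpace F] {ρ : Measure F} [IsFiniteMeasure ρ] {k : ℕ}
    (hmom : Integrable (fun x => ‖x‖ ^ k) ρ) :
    Integrable (fun p : F × F => ‖p.1 - p.2‖ ^ k) (ρ.prod ρ) := by
  refine (((hmom.comp_fst ρ).add (hmom.comp_snd ρ)).const_mul (2 ^ (k - 1))).mono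
    (by fun_prop) (Filter.Eventually.of_forall fun p => ?_)
  have h : (‖p.1‖ + ‖p.2‖) ^ k ≤ 2 ^ (k - 1) * (‖p.1‖ ^ k + ‖p.2‖ ^ k) :=
    add_pow_le (norm_nonneg _) (norm_nonneg _) k
  rw [Real.norm_of_nonneg (by positivity)]
  refine le_trans ?_ (le_abs_self _)
  exact (pow_le_pow_left₀ (norm_nonneg _) (norm_sub_le _ _) k).trans h

theorem HasLaplaceTaylor.exists_polynomial_of_ae_eq_zero {n : ℕ} {ψ : ℝ → ℝ} {ν : Measure ℝ}
    {T : Polynomial ℝ} (h : HasLaplaceTaylor n ψ ν T) (h0 : ∀ᵐ s ∂ν, s = 0) :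
    IsPolynomialOnIci ψ := by
  refine ⟨T + Polynomial.C ((-1) ^ (n + 1) * ν.real univ / ((n + 1).factorial : ℝ)) *
    (Polynomial.X - Polynomial.C 1) ^ (n + 1), fun t ht => ?_⟩
  have h1 : ∫ s, taylorKernel n s t ∂ν = ∫ _, taylorKernel n 0 t ∂ν := by
    refine integral_congr_ae ?_
    filter_upwards [h0] with s hs
    rw [hs]
  rw [h.eq t ht, h1, integral_const, taylorKernel_zero]
  simp
  ring

open Filter Topology in
/-- Injectivity of the potential operator on a separable real Hilbert space, for densities. -/
theorem ae_eq_zero_of_integral_isCM {n : ℕ} {ψ : ℝ → ℝ} (hψ : IsCM (n + 1) ψ)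
    (hpoly : ¬ IsPolynomialOnIci ψ) [Nontrivial E] {ρ : Measure E} [IsFiniteMeasure ρ]
    {g : E → ℝ} (hg : Measurable g) (hg1 : ∀ x, |g x| ≤ 1)
    (hmom : Integrable (fun x => ‖x‖ ^ (2 * n)) ρ)
    (hint : Integrable (fun p : E × E => ψ (‖p.1 - p.2‖ ^ 2)) (ρ.prod ρ))
    (h : ∀ y, ∫ x, ψ (‖x - y‖ ^ 2) * g x ∂ρ = 0) : g =ᵐ[ρ] 0 := by
  obtain ⟨ν, T, hνs, hT⟩ := hψ.exists_hasLaplaceTaylor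
  obtain ⟨e, he⟩ := exists_ne (0 : E)
  -- Exceeds 2 (n + 1), the degree in the shift index of a polynomial of degree n + 1 in the squared
  -- distance.
  set m : ℕ := 2 * n + 3 with hm
  by_cases hG : ∃ s, 0 < s ∧ gaussianForm ρ g e m s = 0
  · obtain ⟨s, hs, hGs⟩ := hG
    exact (gaussianForm_nonneg_and_ae_eq_zero hg hg1 he m hs).2 hGs
  -- If the form is nonzero for every s > 0, then ν turns out to sit at 0, which makes ψ a
  -- polynomial.
  push Not at hG
  refine absurd (hT.exists_polynomial_of_ae_eq_zero ?_) hpoly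
  set Q := ρ.prod ρ with hQ
  have hacont := continuous_shiftSqDist e
  have hann := fun i j p => shiftSqDist_nonneg e i j p
  -- integrability of `ψ` and its Taylor polynomial along the shifted distances
  have hdom : ∀ i j : ℕ, Integrable (fun p => ψ (shiftSqDist e i j p)) Q ∧
      Integrable (fun p => T.eval (shiftSqDist e i j p)) Q := fun i j => by
    obtain ⟨C, hC⟩ := hT.exists_growth_bound hψ.continuousOn
      (c := 2 * ‖((j : ℝ) - i) • e‖ ^ 2) (by positivity)
    have hb : Integrable (fun p : E × E => C * (1 + (‖p.1 - p.2‖ ^ 2) ^ n +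
        |ψ (‖p.1 - p.2‖ ^ 2)|)) Q := by
      simp_rw [← pow_mul]
      exact (((integrable_const _).add (integrable_norm_sub_pow hmom)).add hint.abs).const_mul C
    have hC' := fun p : E × E => hC (‖p.1 - p.2‖ ^ 2) (shiftSqDist e i j p) (sq_nonneg _)
      (hann i j p) (shiftSqDist_le e i j p)
    constructor
    · refine hb.mono (hψ.continuousOn.comp_continuous (hacont i j)
        (hann i j)).aestronglyMeasurable (Eventually.of_forall fun p => ?_)
      exact (hC' p).1.trans (le_abs_self _)
    · refine hb.mono (T.continuous.comp (hacont i j)).aestronglyMeasurable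
        (Eventually.of_forall fun p => ?_)
      exact (hC' p).2.trans (le_abs_self _)
  have hKint : ∀ i j : ℕ, Integrable (fun q : (E × E) × ℝ =>
      taylorKernel n q.2 (shiftSqDist e i j q.1)) (Q.prod ν) := fun i j => by
    have hc : Continuous fun q : (E × E) × ℝ => taylorKernel n q.2 (shiftSqDist e i j q.1) :=
      (continuous_taylorKernel n).comp
        (continuous_snd.prodMk ((hacont i j).comp continuous_fst))
    rw [integrable_prod_iff hc.aestronglyMeasurable]
    refine ⟨Eventually.of_forall fun p => hT.integrable _ (hann i j p), ?_⟩
    refine ((hdom i j).1.sub (hdom i j).2).abs.congr (Eventually.of_forall fun p => ?_)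
    exact (hT.integral_abs (hann i j p)).symm
  have hKg : ∀ i j : ℕ, Integrable (fun q : (E × E) × ℝ =>
      taylorKernel n q.2 (shiftSqDist e i j q.1) * (g q.1.1 * g q.1.2)) (Q.prod ν) := fun i j => by
    refine (hKint i j).mul_bdd (c := 1) (by fun_prop) (Eventually.of_forall fun q => ?_)
    rw [norm_mul]
    exact mul_le_one₀ (hg1 _) (norm_nonneg _) (hg1 _)
  -- every shifted double potential vanishes
  have hzero : ∀ i j : ℕ, ∫ p, ψ (shiftSqDist e i j p) * (g p.1 * g p.2) ∂Q = 0 := fun i j => by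
    rw [hQ, integral_prod_symm _ (integrable_mul_prod hg hg1 (hdom i j).1)]
    refine integral_eq_zero_of_ae (Eventually.of_forall fun y => ?_)
    have h1 := h (y + (i : ℝ) • e - (j : ℝ) • e)
    calc _ = (∫ x, ψ (‖x - (y + (i : ℝ) • e - (j : ℝ) • e)‖ ^ 2) * g x ∂ρ) * g y := by
          rw [← integral_mul_const]
          refine integral_congr_ae (Eventually.of_forall fun x => ?_)
          simp only [shiftSqDist]
          rw [show x - (i : ℝ) • e - (y - (j : ℝ) • e) =
            x - (y + (i : ℝ) • e - (j : ℝ) • e) by abel]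
          ring
      _ = 0 := by rw [h1, zero_mul]
  have hswap : ∀ i j : ℕ, ∫ p, ψ (shiftSqDist e i j p) * (g p.1 * g p.2) ∂Q =
      ∫ p, T.eval (shiftSqDist e i j p) * (g p.1 * g p.2) ∂Q + (-1) ^ (n + 1) *
        ∫ s, ∫ p, taylorKernel n s (shiftSqDist e i j p) * (g p.1 * g p.2) ∂Q ∂ν := fun i j => by
    have h1 := (hKg i j).integral_prod_left
    rw [← integral_integral_swap (hKg i j), ← integral_const_mul,
      ← integral_add (integrable_mul_prod hg hg1 (hdom i j).2) (h1.const_mul _)]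
    refine integral_congr_ae (Eventually.of_forall fun p => ?_)
    simp only
    rw [hT.eq _ (hann i j p), integral_mul_const]
    ring
  -- The differenced energy of the kernel at parameter s. Its ν-integral is zero, while for ν-almost
  -- every s > 0 the function (-1)^(n+1) Γ is a positive multiple of `gaussianForm`.
  set Γ : ℝ → ℝ := fun s => ∑ j ∈ Finset.range (m + 1), ∑ i ∈ Finset.range (m + 1),
    diffCoeff m i * diffCoeff m j *
      ∫ p, taylorKernel n s (shiftSqDist e i j p) * (g p.1 * g p.2) ∂Q with hΓ
  have hΓint : Integrable Γ ν := by
    refine integrable_finsetSum _ fun j _ => integrable_finsetSum _ fun i _ => ?_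
    exact (hKg i j).integral_prod_right.const_mul _
  have hpolyzero : ∀ P : Polynomial ℝ, P.natDegree ≤ n + 1 → ∀ p : E × E,
      ∑ j ∈ Finset.range (m + 1), ∑ i ∈ Finset.range (m + 1),
        diffCoeff m i * diffCoeff m j * P.eval (shiftSqDist e i j p) = 0 := fun P hP p =>
    sum_diffCoeff_mul_eval_shiftSqDist hP (by omega) e p
  -- interchanging the finite sums with an integral over `Q`
  have hsumint : ∀ F : ℕ → ℕ → E × E → ℝ,
      (∀ i j, Integrable (fun p => F i j p * (g p.1 * g p.2)) Q) →
      ∑ j ∈ Finset.range (m + 1), ∑ i ∈ Finset.range (m + 1), diffCoeff m i * diffCoeff m j *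
        ∫ p, F i j p * (g p.1 * g p.2) ∂Q =
      ∫ p, (∑ j ∈ Finset.range (m + 1), ∑ i ∈ Finset.range (m + 1),
        diffCoeff m i * diffCoeff m j * F i j p) * (g p.1 * g p.2) ∂Q := fun F hF => by
    have hF' := fun i j => ((hF i j).const_mul (diffCoeff m i * diffCoeff m j))
    simp_rw [Finset.sum_mul, ← integral_const_mul]
    simp_rw [mul_assoc] at hF' ⊢
    rw [integral_finsetSum _ fun j _ => integrable_finsetSum _ fun i _ => hF' i j]
    exact Finset.sum_congr rfl fun j _ => (integral_finsetSum _ fun i _ => hF' i j).symm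
  have hΓzero : ∫ s, Γ s ∂ν = 0 := by
    have h1 : ∑ j ∈ Finset.range (m + 1), ∑ i ∈ Finset.range (m + 1),
        diffCoeff m i * diffCoeff m j *
          ∫ p, T.eval (shiftSqDist e i j p) * (g p.1 * g p.2) ∂Q = 0 := by
      rw [hsumint _ fun i j => integrable_mul_prod hg hg1 (hdom i j).2]
      simp_rw [hpolyzero T (hT.natDegree_le.trans n.le_succ), zero_mul, integral_zero]
    have h2 : ∫ s, Γ s ∂ν = ∑ j ∈ Finset.range (m + 1), ∑ i ∈ Finset.range (m + 1),
        diffCoeff m i * diffCoeff m j *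
          ∫ s, ∫ p, taylorKernel n s (shiftSqDist e i j p) * (g p.1 * g p.2) ∂Q ∂ν := by
      have hi : ∀ i j : ℕ, Integrable (fun s => diffCoeff m i * diffCoeff m j *
          ∫ p, taylorKernel n s (shiftSqDist e i j p) * (g p.1 * g p.2) ∂Q) ν := fun i j =>
        (hKg i j).integral_prod_right.const_mul _
      rw [hΓ, integral_finsetSum _ fun j _ => integrable_finsetSum _ fun i _ => hi i j]
      refine Finset.sum_congr rfl fun j _ => ?_
      rw [integral_finsetSum _ fun i _ => hi i j]
      exact Finset.sum_congr rfl fun i _ => integral_const_mul _ _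
    have h3 : ∀ i j : ℕ,
        ∫ s, ∫ p, taylorKernel n s (shiftSqDist e i j p) * (g p.1 * g p.2) ∂Q ∂ν =
          -(-1) ^ (n + 1) * ∫ p, T.eval (shiftSqDist e i j p) * (g p.1 * g p.2) ∂Q := fun i j => by
      have h4 := hswap i j
      rw [hzero i j] at h4
      have h5 : ((-1 : ℝ) ^ (n + 1)) * (-1) ^ (n + 1) = 1 := by rw [← mul_pow]; simp
      linear_combination (-1 : ℝ) ^ (n + 1) * (-h4) - (∫ s, ∫ p, taylorKernel n s
        (shiftSqDist e i j p) * (g p.1 * g p.2) ∂Q ∂ν) * h5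
    rw [h2]
    simp_rw [h3]
    rw [← mul_zero (-(-1 : ℝ) ^ (n + 1)), ← h1, Finset.mul_sum]
    refine Finset.sum_congr rfl fun j _ => ?_
    rw [Finset.mul_sum]
    exact Finset.sum_congr rfl fun i _ => by ring
  have hKs : ∀ᵐ s ∂ν, ∀ i j : ℕ, Integrable (fun p =>
      taylorKernel n s (shiftSqDist e i j p) * (g p.1 * g p.2)) Q := by
    rw [ae_all_iff]; intro i; rw [ae_all_iff]; intro j
    exact (hKg i j).prod_left_ae
  have hΓeq : ∀ᵐ s ∂ν, 0 < s → (-1) ^ (n + 1) * Γ s = (s ^ (n + 1))⁻¹ * gaussianForm ρ g e m s := by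
    filter_upwards [hKs] with s hs hs0
    obtain ⟨P, hP, hPK⟩ := exists_polynomial_taylorKernel n s
    rw [if_neg hs0.ne'] at hPK
    have h1 : Γ s = ((-s) ^ (n + 1))⁻¹ * gaussianForm ρ g e m s := by
      rw [hΓ, gaussianForm]
      simp only
      rw [hsumint _ fun i j => hs i j, hsumint _ fun i j => integrable_mul_prod hg hg1
        (integrable_exp_shiftSqDist hs0.le e i j), ← integral_const_mul]
      refine integral_congr_ae (Eventually.of_forall fun p => ?_)
      simp only
      have h2 : ∑ j ∈ Finset.range (m + 1), ∑ i ∈ Finset.range (m + 1),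
          diffCoeff m i * diffCoeff m j * taylorKernel n s (shiftSqDist e i j p) =
          ((-s) ^ (n + 1))⁻¹ * ∑ j ∈ Finset.range (m + 1), ∑ i ∈ Finset.range (m + 1),
            diffCoeff m i * diffCoeff m j * Real.exp (-s * shiftSqDist e i j p) := by
        simp_rw [hPK, mul_add, Finset.sum_add_distrib]
        rw [hpolyzero P hP p, add_zero, Finset.mul_sum]
        refine Finset.sum_congr rfl fun j _ => ?_
        rw [Finset.mul_sum]
        exact Finset.sum_congr rfl fun i _ => by ring
      rw [h2, mul_assoc]
    rw [h1, neg_pow s, mul_inv, ← mul_assoc, ← mul_assoc, mul_inv_cancel₀ (by simp), one_mul]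
  have hΓ0 : ∀ᵐ s ∂ν, s = 0 → Γ s = 0 := by
    filter_upwards [hKs] with s hs hs0
    obtain ⟨P, hP, hPK⟩ := exists_polynomial_taylorKernel n s
    simp_rw [if_pos hs0, zero_mul, zero_add] at hPK
    rw [hΓ]
    simp only
    rw [hsumint _ fun i j => hs i j]
    simp_rw [hPK, hpolyzero P hP, zero_mul, integral_zero]
  have hnn : ∀ᵐ s ∂ν, 0 ≤ (-1) ^ (n + 1) * Γ s := by
    filter_upwards [hΓeq, hΓ0, hT.nonneg] with s h1 h2 h3
    rcases h3.eq_or_lt with h0 | h0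
    · rw [h2 h0.symm, mul_zero]
    · rw [h1 h0]
      have := (gaussianForm_nonneg_and_ae_eq_zero (ρ := ρ) hg hg1 he m h0).1
      positivity
  have hae := (integral_eq_zero_iff_of_nonneg_ae hnn (hΓint.const_mul _)).1
    (by rw [integral_const_mul, hΓzero, mul_zero])
  filter_upwards [hae, hΓeq, hT.nonneg] with s h1 h2 h3
  rcases h3.eq_or_lt with h0 | h0
  · exact h0.symm
  · rw [h2 h0] at h1
    rcases mul_eq_zero.1 h1 with h4 | h4
    · exact absurd h4 (inv_ne_zero (pow_pos h0 _).ne')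
    · exact absurd h4 (hG s h0)

end Core

/-! ### Densities of complex measures with respect to their variation -/

section ComplexMeasure

variable {X : Type*} [MeasurableSpace X]

theorem MeasureTheory.SignedMeasure.isFiniteMeasure_variation (s : SignedMeasure X) :
    IsFiniteMeasure s.variation := by
  rw [← SignedMeasure.totalVariation_eq_variation, SignedMeasure.totalVariation]
  infer_instance

theorem MeasureTheory.ComplexMeasure.isFiniteMeasure_variation (μ : ComplexMeasure X) :
    IsFiniteMeasure μ.variation := by
  have h1 := (ComplexMeasure.re μ).isFiniteMeasure_variation
  have h2 := (ComplexMeasure.im μ).isFiniteMeasure_variation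
  refine isFiniteMeasure_of_le ((ComplexMeasure.re μ).variation + (ComplexMeasure.im μ).variation)
    (VectorMeasure.variation_le_of_forall_enorm_le fun s _ => ?_)
  have h3 : ‖μ s‖ₑ ≤ ‖(μ s).re‖ₑ + ‖(μ s).im‖ₑ := by
    simp only [← ofReal_norm]
    rw [← ENNReal.ofReal_add (norm_nonneg _) (norm_nonneg _)]
    exact ENNReal.ofReal_le_ofReal (Complex.norm_le_abs_re_add_abs_im _)
  refine h3.trans (add_le_add ?_ ?_)
  · exact VectorMeasure.enorm_measure_le_variation (ComplexMeasure.re μ) s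
  · exact VectorMeasure.enorm_measure_le_variation (ComplexMeasure.im μ) s

/-- A signed measure setwise dominated by a finite measure has a density bounded by one. -/
theorem MeasureTheory.SignedMeasure.exists_density {ρ : Measure X} [IsFiniteMeasure ρ]
    (s : SignedMeasure X) (hs : ∀ A, ‖s A‖ₑ ≤ ρ A) :
    ∃ g : X → ℝ, Measurable g ∧ (∀ x, |g x| ≤ 1) ∧
      ∀ A, MeasurableSet A → s A = ∫ x in A, g x ∂ρ := by
  have hac : s ≪ᵥ ρ.toENNRealVectorMeasure := by
    refine VectorMeasure.AbsolutelyContinuous.mk fun A hA h0 => ?_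
    rw [Measure.toENNRealVectorMeasure_apply_measurable hA] at h0
    simpa [h0] using hs A
  have hd := s.withDensityᵥ_rnDeriv_eq ρ hac
  set f := s.rnDeriv ρ with hf
  have hfi : Integrable f ρ := SignedMeasure.integrable_rnDeriv _ _
  have hA : ∀ A, MeasurableSet A → s A = ∫ x in A, f x ∂ρ := fun A hA => by
    rw [← withDensityᵥ_apply hfi hA, hd]
  have hbd : ∀ A, MeasurableSet A → |∫ x in A, f x ∂ρ| ≤ ρ.real A := fun A hA' => by
    rw [← hA A hA', ← Real.norm_eq_abs, ← toReal_enorm]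
    exact ENNReal.toReal_mono (measure_ne_top _ _) (hs A)
  have h1 : f ≤ᵐ[ρ] fun _ => (1 : ℝ) := by
    refine ae_le_of_forall_setIntegral_le hfi (integrable_const _) fun A hA' _ => ?_
    simpa using (le_abs_self _).trans (hbd A hA')
  have h2 : (fun _ => (-1 : ℝ)) ≤ᵐ[ρ] f := by
    refine ae_le_of_forall_setIntegral_le (integrable_const _) hfi fun A hA' _ => ?_
    have := (neg_abs_le _).trans' (neg_le_neg (hbd A hA'))
    simpa using this
  have hfm : Measurable f := SignedMeasure.measurable_rnDeriv _ _
  -- Truncation alters the derivative only on a null set and makes the bound hold everywhere.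
  refine ⟨fun x => max (-1) (min 1 (f x)), measurable_const.max (measurable_const.min hfm),
    fun x => abs_le.2 ⟨le_max_left _ _, max_le (by norm_num) (min_le_left _ _)⟩, fun A hA' => ?_⟩
  rw [hA A hA']
  refine integral_congr_ae (ae_restrict_of_ae ?_)
  filter_upwards [h1, h2] with x hx1 hx2
  rw [min_eq_right hx1, max_eq_right hx2]

/-- Turns vanishing integrals against μ into vanishing scalar integrals against g. It is clear for
indicators, and both sides are continuous in L¹ because g is bounded. -/
theorem MeasureTheory.ComplexMeasure.apply_integral_eq (μ : ComplexMeasure X) (L : ℂ →L[ℝ] ℝ)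
    {g : X → ℝ} (hg : Measurable g) (hg1 : ∀ x, |g x| ≤ 1)
    (hL : ∀ A, MeasurableSet A → L (μ A) = ∫ x in A, g x ∂μ.variation) {f : X → ℝ}
    (hf : Integrable f μ.variation) :
    L (∫ᵛ x, f x ∂•μ) = ∫ x, f x * g x ∂μ.variation := by
  have hfin := μ.isFiniteMeasure_variation
  have hmul : ∀ f : X → ℝ, Integrable f μ.variation →
      Integrable (fun x => f x * g x) μ.variation := fun f hf =>
    hf.mul_bdd (c := 1) hg.aestronglyMeasurable (Filter.Eventually.of_forall hg1)
  refine hf.induction (P := fun f => L (∫ᵛ x, f x ∂•μ) = ∫ x, f x * g x ∂μ.variation)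
    ?_ ?_ ?_ ?_
  · intro c A hA _
    rw [VectorMeasure.integral_indicator_const c hA]
    have h1 : ∀ x, A.indicator (fun _ => c) x * g x = A.indicator (fun x => c * g x) x := fun x => by
      by_cases hx : x ∈ A <;> simp [hx]
    simp_rw [h1]
    rw [integral_indicator hA, integral_const_mul, ← hL A hA, ContinuousLinearMap.lsmul_apply, map_smul,
      smul_eq_mul]
  · intro f₁ f₂ _ hf₁ hf₂ h₁ h₂
    simp only [Pi.add_apply]
    rw [VectorMeasure.integral_fun_add hf₁ hf₂, map_add, h₁, h₂, ← integral_add (hmul _ hf₁)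
      (hmul _ hf₂)]
    simp_rw [add_mul]
  · refine isClosed_eq (L.continuous.comp VectorMeasure.continuous_integral) ?_
    have hg' : MemLp g ⊤ μ.variation := memLp_top_of_bound hg.aestronglyMeasurable 1
      (Filter.Eventually.of_forall hg1)
    let h := ((ContinuousLinearMap.mul ℝ ℝ).lpPairing μ.variation 1 ⊤).flip (hg'.toLp g)
    refine h.continuous.congr fun F => ?_
    rw [ContinuousLinearMap.flip_apply, ContinuousLinearMap.lpPairing_eq_integral]
    refine integral_congr_ae ?_
    filter_upwards [hg'.coeFn_toLp] with x hx
    rw [hx, ContinuousLinearMap.mul_apply']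
  · intro f₁ f₂ h12 _ h
    rw [← VectorMeasure.integral_congr_ae h12, h]
    refine integral_congr_ae ?_
    filter_upwards [h12] with x hx
    rw [hx]

end ComplexMeasure

/-- Fubini provides one centre y₀. Since ‖x - y‖² ≤ 2‖x - y₀‖² + 2‖y₀ - y‖², the growth bound
carries integrability to every other centre. -/
theorem integrable_isCM_norm_sub_sq {F : Type*} [NormedAddCommGroup F]
    [MeasurableSpace F] [BorelSpace F] {n : ℕ} {ψ : ℝ → ℝ} (hψ : IsCM (n + 1) ψ)
    {ρ : Measure F} [IsFiniteMeasure ρ]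
    (hmom : Integrable (fun x => ‖x‖ ^ (2 * n)) ρ)
    (hint : Integrable (fun p : F × F => ψ (‖p.1 - p.2‖ ^ 2)) (ρ.prod ρ)) (y : F) :
    Integrable (fun x => ψ (‖x - y‖ ^ 2)) ρ := by
  rcases eq_or_ne ρ 0 with rfl | hρ
  · exact integrable_zero_measure
  have := NeZero.mk hρ
  obtain ⟨y₀, hy₀⟩ := hint.prod_left_ae.exists
  simp only at hy₀
  obtain ⟨ν, T, -, hT⟩ := hψ.exists_hasLaplaceTaylor
  obtain ⟨C, hC⟩ := hT.exists_growth_bound hψ.continuousOn (c := 2 * ‖y₀ - y‖ ^ 2) (by positivity)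
  have hcont : ∀ z : F, Continuous fun x => ‖x - z‖ := fun z => by fun_prop
  have hmom' : Integrable (fun x => ‖x - y₀‖ ^ (2 * n)) ρ := by
    refine ((hmom.add (integrable_const (‖y₀‖ ^ (2 * n)))).const_mul (2 ^ (2 * n - 1))).mono
      ((hcont y₀).pow _).aestronglyMeasurable (Filter.Eventually.of_forall fun x => ?_)
    rw [Real.norm_of_nonneg (by positivity)]
    refine le_trans ?_ (le_abs_self _)
    exact (pow_le_pow_left₀ (norm_nonneg _) (norm_sub_le _ _) _).trans
      (add_pow_le (norm_nonneg _) (norm_nonneg _) _)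
  have hb : Integrable (fun x => C * (1 + (‖x - y₀‖ ^ 2) ^ n + |ψ (‖x - y₀‖ ^ 2)|)) ρ := by
    simp_rw [← pow_mul]
    exact (((integrable_const _).add hmom').add hy₀.abs).const_mul C
  refine hb.mono (hψ.continuousOn.comp_continuous ((hcont y).pow 2)
    fun x => sq_nonneg ‖x - y‖).aestronglyMeasurable (Filter.Eventually.of_forall fun x => ?_)
  refine (hC (‖x - y₀‖ ^ 2) (‖x - y‖ ^ 2) (sq_nonneg _) (sq_nonneg _) ?_).1.trans (le_abs_self _)
  have h1 : ‖x - y‖ ≤ ‖x - y₀‖ + ‖y₀ - y‖ := norm_sub_le_norm_sub_add_norm_sub _ _ _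
  have h2 := pow_le_pow_left₀ (norm_nonneg _) h1 2
  nlinarith [sq_nonneg (‖x - y₀‖ - ‖y₀ - y‖)]

/-! ### Reduction to a separable subspace and to real densities -/

section Reduction

variable {F : Type*} [NormedAddCommGroup F] [InnerProductSpace ℝ F] [MeasurableSpace F]
  [BorelSpace F]

/-- An inner regular finite measure is carried by a nontrivial closed separable subspace. -/
theorem exists_separable_submodule [Nontrivial F] (ρ : Measure F) [IsFiniteMeasure ρ]
    [ρ.InnerRegular] :
    ∃ S : Submodule ℝ F, IsClosed (S : Set F) ∧ TopologicalSpace.IsSeparable (S : Set F) ∧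
      Nontrivial S ∧ ρ (S : Set F)ᶜ = 0 := by
  obtain ⟨e, he⟩ := exists_ne (0 : F)
  have hex : ∀ k : ℕ, ∃ K : Set F, IsCompact K ∧ ρ Kᶜ ≤ ((k : ENNReal) + 1)⁻¹ := fun k => by
    obtain ⟨K, -, hK, h⟩ := MeasurableSet.univ.exists_isCompact_sdiff_lt (μ := ρ)
      (measure_ne_top _ _) (ε := ((k : ENNReal) + 1)⁻¹) (by simp)
    exact ⟨K, hK, by rw [compl_eq_univ_sdiff]; exact h.le⟩
  choose K hK hKρ using hex
  -- Adding e keeps the subspace nontrivial even if ρ is zero or concentrated at the origin.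
  set A : Set F := insert e (⋃ k, K k) with hA
  have hAsep : TopologicalSpace.IsSeparable A := by
    rw [hA, insert_eq]
    exact (finite_singleton e).isSeparable.union
      (TopologicalSpace.IsSeparable.iUnion fun k => (hK k).isSeparable)
  have hAS : A ⊆ ((Submodule.span ℝ A).topologicalClosure : Set F) :=
    Submodule.subset_span.trans (Submodule.le_topologicalClosure _)
  refine ⟨(Submodule.span ℝ A).topologicalClosure, Submodule.isClosed_topologicalClosure _,
    hAsep.span.closure, ⟨⟨⟨e, hAS (mem_insert _ _)⟩, 0, fun h => he ?_⟩⟩, ?_⟩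
  · simpa using congrArg Subtype.val h
  · refine le_antisymm (ge_of_tendsto' (f := fun k : ℕ => ((k : ENNReal) + 1)⁻¹)
      (x := Filter.atTop) ?_ fun k => ?_) zero_le
    · have := ENNReal.tendsto_inv_nat_nhds_zero.comp (Filter.tendsto_add_atTop_nat 1)
      refine this.congr fun k => ?_
      simp
    · refine (measure_mono (compl_subset_compl.2 ?_)).trans (hKρ k)
      exact ((subset_iUnion K k).trans (subset_insert _ _)).trans hAS

variable [CompleteSpace F] [Nontrivial F]

/-- Everything is pulled back to a separable closed subspace carrying ρ; there it is enough that the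
potential vanishes at centres in the subspace. -/
theorem ae_eq_zero_of_integral_isCM_of_innerRegular {n : ℕ} {ψ : ℝ → ℝ} (hψ : IsCM (n + 1) ψ)
    (hpoly : ¬ IsPolynomialOnIci ψ) {ρ : Measure F} [IsFiniteMeasure ρ] [ρ.InnerRegular]
    {g : F → ℝ} (hg : Measurable g) (hg1 : ∀ x, |g x| ≤ 1)
    (hmom : Integrable (fun x => ‖x‖ ^ (2 * n)) ρ)
    (hint : Integrable (fun p : F × F => ψ (‖p.1 - p.2‖ ^ 2)) (ρ.prod ρ))
    (h : ∀ y, ∫ x, ψ (‖x - y‖ ^ 2) * g x ∂ρ = 0) : g =ᵐ[ρ] 0 := by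
  obtain ⟨S, hS, hsep, hnt, hρ⟩ := exists_separable_submodule ρ
  have hemb : MeasurableEmbedding (Subtype.val : S → F) :=
    MeasurableEmbedding.subtype_coe hS.measurableSet
  have := hsep.separableSpace
  have : SecondCountableTopology S := UniformSpace.secondCountable_of_separable _
  have : CompleteSpace S := hS.completeSpace_coe
  set ρ' : Measure S := ρ.comap Subtype.val with hρ'
  have hmap : ρ = ρ'.map Subtype.val := by
    rw [hρ', hemb.map_comap, Subtype.range_coe, Measure.restrict_eq_self_of_ae_mem]
    exact mem_ae_iff.2 hρ
  have hfin : IsFiniteMeasure ρ' := ⟨by rw [hρ', hemb.comap_apply]; exact measure_lt_top _ _⟩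
  have hprod : ρ.prod ρ = (ρ'.prod ρ').map (Prod.map Subtype.val Subtype.val) := by
    conv_lhs => rw [hmap]
    exact Measure.map_prod_map _ _ hemb.measurable hemb.measurable
  have key : (fun x : S => g x) =ᵐ[ρ'] 0 := by
    refine ae_eq_zero_of_integral_isCM hψ hpoly (ρ := ρ') (g := fun x : S => g x)
      (hg.comp hemb.measurable) (fun x => hg1 x) ?_ ?_ fun y => ?_
    · rw [hmap, hemb.integrable_map_iff] at hmom
      exact hmom
    · rw [hprod, (hemb.prodMap hemb).integrable_map_iff] at hint
      exact hint
    · rw [← h y]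
      conv_rhs => rw [hmap]
      rw [hemb.integral_map]
      rfl
  rw [hmap, Filter.EventuallyEq, hemb.ae_map_iff]
  exact key

/-- Injectivity of the potential operator for complex measures. -/
theorem eq_zero_of_integral_isCM {n : ℕ} {ψ : ℝ → ℝ} (hψ : IsCM (n + 1) ψ)
    (hpoly : ¬ IsPolynomialOnIci ψ) {μ : ComplexMeasure F} [μ.variation.InnerRegular]
    (hmom : Integrable (fun x => ‖x‖ ^ (2 * n)) μ.variation)
    (hint : Integrable (fun p : F × F => ψ (‖p.1 - p.2‖ ^ 2)) (μ.variation.prod μ.variation))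
    (h : ∀ y, ∫ᵛ x, ψ (‖x - y‖ ^ 2) ∂•μ = 0) : μ = 0 := by
  have hfin := μ.isFiniteMeasure_variation
  -- Covers the real and imaginary parts at once: a contraction L makes L ∘ μ setwise dominated by
  -- the variation.
  have key : ∀ L : ℂ →L[ℝ] ℝ, (∀ z, ‖L z‖ ≤ ‖z‖) → ∀ A, MeasurableSet A → L (μ A) = 0 := by
    intro L hL
    obtain ⟨g, hg, hg1, hd⟩ := SignedMeasure.exists_density (ρ := μ.variation)
      (μ.mapRange L.toLinearMap.toAddMonoidHom L.continuous) fun A =>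
        (enorm_le_iff_norm_le.2 (hL _)).trans (VectorMeasure.enorm_measure_le_variation μ A)
    have hd' : ∀ A, MeasurableSet A → L (μ A) = ∫ x in A, g x ∂μ.variation := hd
    have h0 := ae_eq_zero_of_integral_isCM_of_innerRegular hψ hpoly hg hg1 hmom hint fun y => by
      rw [← μ.apply_integral_eq L hg hg1 hd' (integrable_isCM_norm_sub_sq hψ hmom hint y), h y,
        map_zero]
    intro A hA
    rw [hd' A hA]
    exact integral_eq_zero_of_ae (ae_restrict_of_ae h0)
  ext A hA
  refine Complex.ext ?_ ?_
  · exact key Complex.reCLM (fun z => Complex.abs_re_le_norm z) A hA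
  · exact key Complex.imCLM (fun z => Complex.abs_im_le_norm z) A hA

end Reduction

/-! ### Powers, logarithms and the main theorem -/

theorem neg_one_pow_mul_descPochhammer_eval_nonneg {b : ℝ} (hb : 0 ≤ b) (k : ℕ) :
    0 ≤ (-1 : ℝ) ^ k * (descPochhammer ℝ k).eval (-b) := by
  rw [descPochhammer_eval_eq_prod_range, ← Finset.card_range k, ← Finset.prod_const,
    Finset.card_range, ← Finset.prod_mul_distrib]
  refine Finset.prod_nonneg fun i _ => ?_
  have : (0 : ℝ) ≤ i := i.cast_nonneg
  linarith

/-- A function whose derivative of order `n + 1` is a negative power belongs to `CM_(n+1)` up to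
sign, and is not a polynomial. -/
theorem isCM_or_isCM_neg_of_iteratedDeriv_eq {n : ℕ} {ψ : ℝ → ℝ} {b c : ℝ} (hb : 0 < b)
    (hc : c ≠ 0) (hcont : ContinuousOn ψ (Ici 0)) (hsmooth : ContDiffOn ℝ ∞ ψ (Ioi 0))
    (hder : ∀ t, 0 < t → iteratedDeriv (n + 1) ψ t = c * t ^ (-b)) :
    (IsCM (n + 1) ψ ∨ IsCM (n + 1) fun t => -ψ t) ∧ ¬ IsPolynomialOnIci ψ := by
  have hcm : ∀ d : ℝ, 0 ≤ d → ∀ f : ℝ → ℝ, (∀ t, 0 < t → f t = d * t ^ (-b)) →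
      IsCompletelyMonotone f := fun d hd f hf => by
    refine ⟨?_, fun k t ht => ?_⟩
    · refine ContDiffOn.congr (f := fun t : ℝ => d * t ^ (-b)) ?_ hf
      exact contDiffOn_const.mul (contDiffOn_id.rpow_const_of_ne fun t ht => (mem_Ioi.1 ht).ne')
    · have h1 : f =ᶠ[nhds t] fun t => d * t ^ (-b) :=
        Filter.eventuallyEq_of_mem (Ioi_mem_nhds ht) hf
      rw [h1.iteratedDeriv_eq, iteratedDeriv_const_mul_field, iteratedDeriv_eq_iterate,
        Real.iter_deriv_rpow_const]
      have h2 := neg_one_pow_mul_descPochhammer_eval_nonneg hb.le k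
      have h3 := Real.rpow_nonneg ht.le (-b - k)
      have := mul_nonneg (mul_nonneg hd h2) h3
      linarith
  refine ⟨?_, ?_⟩
  · rcases le_total 0 ((-1) ^ (n + 1) * c) with h | h
    · refine Or.inl ⟨hcont, hsmooth, hcm _ h _ fun t ht => ?_⟩
      rw [hder t ht, mul_assoc]
    · refine Or.inr ⟨hcont.neg, hsmooth.neg, hcm (-((-1) ^ (n + 1) * c)) (by linarith) _
        fun t ht => ?_⟩
      rw [iteratedDeriv_fun_neg, hder t ht]
      ring
  -- For a polynomial, the derivative of order n + 1 times t ^ b is continuous with value 0 at 0,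
  -- because b > 0; but it equals c ≠ 0 for t > 0.
  · rintro ⟨p, hp⟩
    have h1 : ∀ t, 0 < t → iteratedDeriv (n + 1) (fun t => p.eval t) t * t ^ b = c := fun t ht => by
      have h2 : ψ =ᶠ[nhds t] fun t => p.eval t :=
        Filter.eventuallyEq_of_mem (Ioi_mem_nhds ht) fun s hs => hp s (mem_Ioi.1 hs).le
      rw [← h2.iteratedDeriv_eq, hder t ht, mul_assoc, ← Real.rpow_add ht, neg_add_cancel,
        Real.rpow_zero, mul_one]
    have h3 : Continuous fun t => iteratedDeriv (n + 1) (fun t => p.eval t) t * t ^ b :=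
      ((show ContDiff ℝ ∞ fun t => p.eval t by
      simpa using p.contDiff_aeval (𝕜 := ℝ) ∞).continuous_iteratedDeriv (n + 1) (n := ∞)
      (by exact_mod_cast le_top)).mul
        (Real.continuous_rpow_const hb.le)
    have h4 := (h3.tendsto 0).mono_left (nhdsWithin_le_nhds (s := Ioi 0))
    have h5 : Filter.Tendsto (fun t => iteratedDeriv (n + 1) (fun t => p.eval t) t * t ^ b)
        (nhdsWithin 0 (Ioi 0)) (nhds c) :=
      tendsto_const_nhds.congr' (by
        filter_upwards [self_mem_nhdsWithin] with t ht using (h1 t ht).symm)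
    have h6 := tendsto_nhds_unique h4 h5
    rw [Real.zero_rpow hb.ne', mul_zero] at h6
    exact hc h6.symm

theorem isCM_or_isCM_neg_of_rpow {n : ℕ} {ψ : ℝ → ℝ} {r : ℝ} (h1 : n < r) (h2 : r < n + 1)
    (hψ : ∀ t, 0 ≤ t → ψ t = t ^ r) :
    (IsCM (n + 1) ψ ∨ IsCM (n + 1) fun t => -ψ t) ∧ ¬ IsPolynomialOnIci ψ := by
  have hn : (0 : ℝ) ≤ n := n.cast_nonneg
  -- Here c = r (r - 1) ⋯ (r - n), which is nonzero because r > n.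
  refine isCM_or_isCM_neg_of_iteratedDeriv_eq (b := n + 1 - r)
    (c := (descPochhammer ℝ (n + 1)).eval r) (by linarith) ?_ ?_ ?_ fun t ht => ?_
  · rw [descPochhammer_eval_eq_prod_range, Finset.prod_ne_zero_iff]
    intro i hi
    have : (i : ℝ) ≤ n := by exact_mod_cast Nat.lt_succ_iff.1 (Finset.mem_range.1 hi)
    exact (by linarith : 0 < r - i).ne'
  · exact (Real.continuous_rpow_const (by linarith)).continuousOn.congr hψ
  · refine ContDiffOn.congr (f := fun t : ℝ => t ^ r) ?_ fun t ht => hψ t (mem_Ioi.1 ht).le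
    exact contDiffOn_id.rpow_const_of_ne fun t ht => (mem_Ioi.1 ht).ne'
  · have h3 : ψ =ᶠ[nhds t] fun t => t ^ r :=
      Filter.eventuallyEq_of_mem (Ioi_mem_nhds ht) fun s hs => hψ s (mem_Ioi.1 hs).le
    rw [h3.iteratedDeriv_eq, iteratedDeriv_eq_iterate, Real.iter_deriv_rpow_const]
    congr 2
    push_cast
    ring

/-- Differentiating t^(n+1) log t once gives (n + 1) t^n log t + t^n, and n + 1 further derivatives
kill the extra monomial. -/
theorem iteratedDeriv_pow_mul_log (n : ℕ) {t : ℝ} (ht : 0 < t) :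
    iteratedDeriv (n + 1) (fun t => t ^ n * Real.log t) t = n.factorial * t⁻¹ := by
  induction n generalizing t with
  | zero => simp [iteratedDeriv_one]
  | succ n ih =>
    have hd : deriv (fun t => t ^ (n + 1) * Real.log t) =ᶠ[nhds t]
        (fun t => ((n + 1 : ℕ) : ℝ) * (t ^ n * Real.log t)) + fun t => t ^ n := by
      refine Filter.eventuallyEq_of_mem (Ioi_mem_nhds ht) fun s hs => ?_
      have hs' := (mem_Ioi.1 hs).ne'
      have h := (hasDerivAt_pow (n + 1) s).mul (Real.hasDerivAt_log hs')
      refine h.deriv.trans ?_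
      simp only [Pi.add_apply, Nat.add_sub_cancel]
      field_simp
      ring
    have hlog : ContDiffAt ℝ ((n + 1 : ℕ) : WithTop ℕ∞) (fun t => t ^ n * Real.log t) t :=
      (contDiffAt_id.pow n).mul (Real.contDiffAt_log.2 ht.ne')
    have hpow : ContDiffAt ℝ ((n + 1 : ℕ) : WithTop ℕ∞) (fun t : ℝ => t ^ n) t := by fun_prop
    rw [iteratedDeriv_succ', hd.iteratedDeriv_eq, iteratedDeriv_add (contDiffAt_const.mul hlog)
      hpow, iteratedDeriv_const_mul_field, ih ht]
    have : iteratedDeriv (n + 1) (fun t : ℝ => t ^ n) t = 0 := by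
      simp
    rw [this, Nat.factorial_succ]
    push_cast
    ring

theorem isCM_or_isCM_neg_of_pow_mul_log {n : ℕ} (hn : n ≠ 0) {ψ : ℝ → ℝ}
    (hψ : ∀ t, 0 ≤ t → ψ t = t ^ n * Real.log t) :
    (IsCM (n + 1) ψ ∨ IsCM (n + 1) fun t => -ψ t) ∧ ¬ IsPolynomialOnIci ψ := by
  refine isCM_or_isCM_neg_of_iteratedDeriv_eq (b := 1) (c := n.factorial) one_pos
    (by positivity) ?_ ?_ fun t ht => ?_
  -- Since n ≥ 1, one factor t absorbs the singularity of the logarithm at 0.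
  · obtain ⟨m, rfl⟩ := Nat.exists_eq_succ_of_ne_zero hn
    refine ContinuousOn.congr (f := fun t : ℝ => t ^ m * (t * Real.log t))
      ((continuous_pow m).mul Real.continuous_mul_log).continuousOn fun t ht => ?_
    rw [hψ t ht, pow_succ, mul_assoc]
  · refine ContDiffOn.congr (f := fun t : ℝ => t ^ n * Real.log t) ?_
      fun t ht => hψ t (mem_Ioi.1 ht).le
    exact (contDiffOn_id.pow n).mul (contDiffOn_id.log fun t ht => (mem_Ioi.1 ht).ne')
  · have h3 : ψ =ᶠ[nhds t] fun t => t ^ n * Real.log t :=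
      Filter.eventuallyEq_of_mem (Ioi_mem_nhds ht) fun s hs => hψ s (mem_Ioi.1 hs).le
    rw [h3.iteratedDeriv_eq, iteratedDeriv_pow_mul_log n ht, Real.rpow_neg_one]

theorem lemma5p2 {𝕜 : Type*} [RCLike 𝕜] {H : Type*} [NormedAddCommGroup H]
    [InnerProductSpace 𝕜 H] [CompleteSpace H] [Nontrivial H]
    [MeasurableSpace H] [BorelSpace H]
    (ℓ : ℕ) (hℓ : 1 ≤ ℓ) (ψ : ℝ → ℝ)
    (μ : ComplexMeasure H) (hμ : IsRadonComplexMeasure μ)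
    (hmoment : Integrable (fun x : H => ‖x‖ ^ (2 * (ℓ - 1))) μ.variation)
    (hint : Integrable (fun p : H × H => ψ (‖p.1 - p.2‖ ^ 2)) (μ.variation.prod μ.variation))
    (hψ :
      (∃ a : ℝ, 2 * ((ℓ : ℝ) - 1) < a ∧ a < 2 * (ℓ : ℝ) ∧
        ∀ t : ℝ, 0 ≤ t → ψ t = t ^ (a / 2)) ∨
      (1 < ℓ ∧ ∀ t : ℝ, 0 ≤ t → ψ t = t ^ (ℓ - 1) * Real.log t) ∨
      (ℓ = 1 ∧ IsCM 1 ψ ∧ ¬ IsPolynomialOnIci ψ ∧ ψ 0 ≤ 0) ∨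
      (ℓ = 2 ∧ IsCM 2 ψ ∧ ¬ IsPolynomialOnIci ψ ∧ ψ 0 ≤ 0 ∧
        Integrable (fun x : H => ‖x‖ ^ 4) μ.variation)) :
    (∀ y : H, Integrable (fun x : H => ψ (‖x - y‖ ^ 2)) μ.variation) ∧
    ((∀ y : H, ∫ᵛ x, ψ (‖x - y‖ ^ 2) ∂•μ = 0) ↔ μ = 0) := by
  obtain ⟨n, rfl⟩ : ∃ n, ℓ = n + 1 := ⟨ℓ - 1, by omega⟩
  rw [Nat.add_sub_cancel] at hmoment
  -- The assertion is invariant under ψ ↦ -ψ, so membership in CM_(n+1) is needed only up to sign.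
  have hcases : (IsCM (n + 1) ψ ∨ IsCM (n + 1) fun t => -ψ t) ∧ ¬ IsPolynomialOnIci ψ := by
    rcases hψ with ⟨a, h1, h2, h⟩ | ⟨h1, h⟩ | ⟨h1, h, h', -⟩ | ⟨h1, h, h', -⟩
    · push_cast at h1 h2
      exact isCM_or_isCM_neg_of_rpow (r := a / 2) (by linarith) (by linarith) h
    · exact isCM_or_isCM_neg_of_pow_mul_log (by omega) h
    · obtain rfl : n = 0 := by omega
      exact ⟨Or.inl h, h'⟩
    · obtain rfl : n = 1 := by omega
      exact ⟨Or.inl h, h'⟩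
  -- Only the norm enters the statement, so H may be regarded as a real Hilbert space.
  let _ := InnerProductSpace.rclikeToReal 𝕜 H
  have hfin := μ.isFiniteMeasure_variation
  have hinner := hμ.innerRegular
  refine ⟨fun y => ?_, fun h => ?_, fun h y => ?_⟩
  · rcases hcases.1 with hc | hc
    · exact integrable_isCM_norm_sub_sq hc hmoment hint y
    · simpa using (integrable_isCM_norm_sub_sq hc hmoment hint.neg y).neg
  · rcases hcases.1 with hc | hc
    · exact eq_zero_of_integral_isCM hc hcases.2 hmoment hint h
    · refine eq_zero_of_integral_isCM hc ?_ hmoment hint.neg fun y => ?_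
      · rintro ⟨p, hp⟩
        exact hcases.2 ⟨-p, fun t ht => by rw [Polynomial.eval_neg, ← hp t ht, neg_neg]⟩
      · rw [VectorMeasure.integral_fun_neg, h y, neg_zero]
  · rw [h, VectorMeasure.integral_zero_vectorMeasure]
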